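/- A flow $(S_t)_{t\in\mathbb{R}}$ on a probability space is a jointly measurable, measure-preserving action of the group $\mathbb{R}$, and it is ergodic if every measurable set $A$ with $\mu(S_t^{-1}A\,\triangle\,A)=0$ for all $t$ has measure $0$ or $1$. Let $(X,d)$ be a $\sigma$-compact metric space with Borel $\sigma$-algebra $\mathcal{B}$, let $\mu$ be a probability measure on $(X,\mathcal{B})$, let $(S_t)_{t\in\mathbb{R}}$ be a flow on $(X,\mathcal{B},\mu)$, and let $P\subset\mathbb{R}\setminus\{0\}$ be a nonempty finite set. For $t_0\in\mathbb{R}\setminus\{0\}$ the flow $(S_t)$ has the property $\mathrm{R}(t_0,P)$ if for every $\varepsilon>0$ there is $\kappa=\kappa(\varepsilon)>0$ such that for every $N\in\mathbb{N}$ there are $\delta=\delta(\varepsilon,N)>0$ and $Z=Z(\varepsilon,N)\in\mathcal{B}$ with $\mu(Z)>1-\varepsilon$ such that: whenever $x,x'\in Z$, $x'$ is not in the orbit of $x$ and $d(x,x')<\delta$, there are natural numbers $M,L\geq N$ with $L/M\geq\kappa$ and there is $p\in P$ such that \[\frac{\#\{n\in\mathbb{Z}\cap[M,M+L]: d(S_{nt_0}x,\,S_{nt_0+p}x')<\varepsilon\}}{L}>1-\varepsilon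 .\] The flow $(S_t)$ has the property $\mathrm{R}(P)$ if the set of all $s\in\mathbb{R}\setminus\{0\}$ such that $(S_t)$ has the property $\mathrm{R}(s,P)$ is uncountable. **Theorem.** Assume that $(S_t)_{t\in\mathbb{R}}$ is ergodic, that for every $p\in P$ the automorphism $S_p$ of $(X,\mathcal{B},\mu)$ is ergodic, and that $(S_t)_{t\in\mathbb{R}}$ has the property $\mathrm{R}(P)$. Let $(T_t)_{t\in\mathbb{R}}$ be an ergodic flow on a standard Borel probability space $(Y,\mathcal{C},\nu)$, and let $\rho$ be an ergodic joining of $(S_t)$ and $(T_t)$, i.e. a probability measure on $(X\times Y,\mathcal{B}\otimes\mathcal{C})$ with marginals $\mu$ and $\nu$ that is invariant and ergodic under the flow $(S_t\times T_t)_{t\in\mathbb{R}}$. Then $\rho=\mu\otimes\nu$, or $\rho$ is a finite extension of $\nu$, i.e. there is an integer $k\geq 1$ such that in the disintegration $\rho=\int_Y\rho_y\,d\nu(y)$ of $\rho$ over the projection $X\times Y\to Y$, for $\nu$-almost every $y$ the fibre measure $\rho_y$ is the uniform probability measure on $k$ distinct points of $X\times\{y\}$. -/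

import Mathlib

open MeasureTheory ProbabilityTheory
open scoped ENNReal

/-!
A flow `(S_t)` on a measurable space `X` is a jointly measurable action of the additive group `ℝ`
on `X`, that is `[AddAction ℝ X] [MeasurableVAdd₂ ℝ X]`, and `S_t x` is written `t +ᵥ x`.  The flow
is measure preserving and ergodic for `μ` when `ErgodicVAdd ℝ X μ` holds.  On `X × Y` the product
action is `t +ᵥ (x, y) = (t +ᵥ x, t +ᵥ y)`, i.e. the flow `(S_t × T_t)`.
-/

/-- The property `R(t₀, P)` of a flow on a metric space `X` with a Borel measure `μ`.
The number `κ` depends on `ε` only, while `δ` and `Z` depend on `ε` and `N`. -/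
def RatnerPropertyAt {X : Type*} [MetricSpace X] [MeasurableSpace X] [AddAction ℝ X]
    (μ : Measure X) (t₀ : ℝ) (P : Finset ℝ) : Prop :=
  t₀ ≠ 0 ∧
  ∀ ε : ℝ, 0 < ε → ∃ κ : ℝ, 0 < κ ∧
    ∀ N : ℕ, ∃ δ : ℝ, 0 < δ ∧ ∃ Z : Set X, MeasurableSet Z ∧ 1 - ε < μ.real Z ∧
      ∀ x ∈ Z, ∀ x' ∈ Z, x' ∉ AddAction.orbit ℝ x → dist x x' < δ →
        ∃ M L : ℕ, N ≤ M ∧ N ≤ L ∧ κ ≤ (L : ℝ) / M ∧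
          ∃ p ∈ P,
            1 - ε <
              (Set.ncard {n : ℤ | n ∈ Set.Icc (M : ℤ) (M + L) ∧
                dist ((n * t₀ : ℝ) +ᵥ x) ((n * t₀ + p : ℝ) +ᵥ x') < ε} : ℝ) / L

/-- The property `R(P)`: the flow has the property `R(s, P)` for uncountably many `s`. -/
def RatnerProperty {X : Type*} [MetricSpace X] [MeasurableSpace X] [AddAction ℝ X]
    (μ : Measure X) (P : Finset ℝ) : Prop :=
  ¬ {s : ℝ | RatnerPropertyAt μ s P}.Countable

/-- `ρ` is a joining of the flows on `(X, μ)` and `(Y, ν)`: a probability measure on `X × Y`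
invariant under the product flow, with marginals `μ` and `ν`. -/
structure IsJoining {X Y : Type*} [MeasurableSpace X] [MeasurableSpace Y]
    [AddAction ℝ X] [AddAction ℝ Y] (μ : Measure X) (ν : Measure Y) (ρ : Measure (X × Y)) :
    Prop where
  isProbabilityMeasure : IsProbabilityMeasure ρ
  invariant : VAddInvariantMeasure ℝ (X × Y) ρ
  map_fst : ρ.map Prod.fst = μ
  map_snd : ρ.map Prod.snd = ν

/-- `(W, ρ)` is a finite extension of `(Y, ν)` through the map `π : W → Y`: for some `k ≥ 1` the
measure `ρ` has a disintegration `ρ = ∫ η y dν(y)` over `ν` in which, for almost every `y`, the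
fibre measure `η y` is the uniform measure on `k` distinct points of the fibre of `π` over `y`.
(For an ergodic `ρ`, it is the same to ask that almost every fibre measure has finite support.) -/
def IsFiniteExtension {W Y : Type*} [MeasurableSpace W] [MeasurableSpace Y]
    (π : W → Y) (ρ : Measure W) (ν : Measure Y) : Prop :=
  ∃ k : ℕ, 1 ≤ k ∧ ∃ η : Kernel Y W, ν.bind η = ρ ∧
    ∀ᵐ y ∂ν, ∃ F : Finset W, F.card = k ∧ (∀ w ∈ F, π w = y) ∧
      η y = (k : ℝ≥0∞)⁻¹ • ∑ w ∈ F, Measure.dirac w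

/-! Suppose `ρ ≠ μ.prod ν`. For an ergodic flow on a countably generated space only countably many
time-`s` maps fail to be ergodic (`countable_setOf_not_ergodic`), while the Ratner property holds at
uncountably many times. So some `t₀` has the Ratner property and acts ergodically on `(X × Y, ρ)`.

Write `(t, 0)` for the translation of the first coordinate by `t`. If some `(p, 0)` with `p ∈ P`
preserved `ρ`, ergodicity of `S_p` would force `ρ` to be the product. Hence for each `p ∈ P` a
Lipschitz test function has different integrals against `ρ` and against its image under `(p, 0)`.
Take `(x, y)` and `(x', y)` in a large set on which Birkhoff averages converge uniformly. If `x` and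
`x'` were close but on different orbits, the Ratner property would make the Birkhoff sums of the
test function and of its translate agree over a long window, a contradiction. This is
`RatnerPropertyAt.exists_fibre_separated`: on the fibres of a set `W` of positive measure, nearby
points share an orbit.

If `(x, y)` and `(t +ᵥ x, y)` are both generic, then `t` lies in a closed subgroup of `ℝ` whose
elements preserve `ρ` as translations `(t, 0)`. This subgroup is proper, hence countable, so `W` has
countably many generic points in each fibre and the fibre measures cannot all be atomless. The mass
`fibreMass` is invariant under the time-`t₀` map, hence almost everywhere a constant `c > 0`, and
the fibre measures are uniform on `1 / c` points. -/

open Filter Topology Set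

/-! ### The pointwise ergodic theorem for bounded functions -/

section Birkhoff

variable {Z : Type*}

/-- The running maximum `max (0, S₁ g, …, Sₙ g)` of the Birkhoff sums of `g`. -/
noncomputable def birkhoffMax (T : Z → Z) (g : Z → ℝ) : ℕ → Z → ℝ
  | 0 => fun _ => 0
  | n + 1 => fun z => max 0 (g z + birkhoffMax T g n (T z))

theorem birkhoffMax_succ (T : Z → Z) (g : Z → ℝ) (n : ℕ) (z : Z) :
    birkhoffMax T g (n + 1) z = max 0 (g z + birkhoffMax T g n (T z)) := rfl

theorem birkhoffMax_nonneg (T : Z → Z) (g : Z → ℝ) (n : ℕ) (z : Z) :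
    0 ≤ birkhoffMax T g n z := by
  cases n with
  | zero => exact le_rfl
  | succ n => exact le_max_left _ _

theorem birkhoffMax_mono (T : Z → Z) (g : Z → ℝ) (z : Z) :
    Monotone fun n => birkhoffMax T g n z := by
  refine monotone_nat_of_le_succ fun n => ?_
  induction n generalizing z with
  | zero => exact birkhoffMax_nonneg T g 1 z
  | succ n ih =>
    simp only [birkhoffMax_succ T g] at ih ⊢
    exact max_le_max le_rfl (add_le_add_right (ih (T z)) _)

theorem birkhoffSum_le_birkhoffMax (T : Z → Z) (g : Z → ℝ) (n : ℕ) (z : Z) :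
    birkhoffSum T g n z ≤ birkhoffMax T g n z := by
  induction n generalizing z with
  | zero => simp [birkhoffMax]
  | succ n ih =>
    rw [birkhoffSum_succ', birkhoffMax_succ]
    exact (add_le_add_right (ih (T z)) _).trans (le_max_right _ _)

theorem birkhoffMax_le (T : Z → Z) {g : Z → ℝ} {C : ℝ} (hC : ∀ z, |g z| ≤ C) (n : ℕ) (z : Z) :
    birkhoffMax T g n z ≤ n * C := by
  induction n generalizing z with
  | zero => simp [birkhoffMax]
  | succ n ih =>
    have h0 : 0 ≤ C := (abs_nonneg _).trans (hC z)
    rw [birkhoffMax_succ]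
    refine max_le (by positivity) ?_
    have := ih (T z)
    have := (le_abs_self _).trans (hC z)
    push_cast
    linarith

/-- The recursion changes the maxima at `z` and at `T z` by a bounded amount only. Boundedness is
thus a strictly invariant event, to which ergodicity applies. -/
theorem bddAbove_birkhoffMax_iff (T : Z → Z) (g : Z → ℝ) (z : Z) :
    BddAbove (range fun n => birkhoffMax T g n (T z)) ↔
      BddAbove (range fun n => birkhoffMax T g n z) := by
  constructor
  · rintro ⟨b, hb⟩
    refine ⟨max 0 (g z + b), ?_⟩
    rintro _ ⟨n, rfl⟩
    refine (birkhoffMax_mono T g z n.le_succ).trans ?_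
    exact max_le_max le_rfl (add_le_add_right (hb ⟨n, rfl⟩) _)
  · rintro ⟨b, hb⟩
    refine ⟨b - g z, ?_⟩
    rintro _ ⟨n, rfl⟩
    have h1 : birkhoffMax T g (n + 1) z ≤ b := hb ⟨n + 1, rfl⟩
    rw [birkhoffMax_succ] at h1
    have := (le_max_right _ _).trans h1
    simp only
    linarith

variable [MeasurableSpace Z] {ρ : Measure Z}

theorem measurable_birkhoffMax {T : Z → Z} (hT : Measurable T) {g : Z → ℝ} (hg : Measurable g)
    (n : ℕ) : Measurable (birkhoffMax T g n) := by
  induction n with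
  | zero => exact measurable_const
  | succ n ih => exact measurable_const.max (hg.add (ih.comp hT))

/-- Otherwise the maxima tend to infinity almost everywhere. With `M n` the maximum, `M (n + 1) - M
n ∘ T = max g (-M n ∘ T)` has nonnegative integral, since `M n` increases with `n` and `T` preserves
`ρ`. By dominated convergence these integrals tend to `∫ g`, which is then nonnegative. -/
theorem ae_bddAbove_birkhoffMax [IsProbabilityMeasure ρ] {T : Z → Z} (hT : Ergodic T ρ) {g : Z → ℝ}
    (hg : Measurable g) {C : ℝ} (hC : ∀ z, |g z| ≤ C) (hneg : ∫ z, g z ∂ρ < 0) :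
    ∀ᵐ z ∂ρ, BddAbove (range fun n => birkhoffMax T g n z) := by
  have hmeas := measurable_birkhoffMax hT.measurable hg
  have hint : ∀ n, Integrable (birkhoffMax T g n) ρ := fun n =>
    Integrable.of_bound (hmeas n).aestronglyMeasurable (n * C) (ae_of_all _ fun z => by
      rw [Real.norm_eq_abs, abs_of_nonneg (birkhoffMax_nonneg T g n z)]
      exact birkhoffMax_le T hC n z)
  have hE : MeasurableSet {z | BddAbove (range fun n => birkhoffMax T g n z)} :=
    measurableSet_bddAbove_range hmeas
  have hinv : T ⁻¹' {z | BddAbove (range fun n => birkhoffMax T g n z)} =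
      {z | BddAbove (range fun n => birkhoffMax T g n z)} :=
    Set.ext fun z => bddAbove_birkhoffMax_iff T g z
  rcases hT.toPreErgodic.ae_mem_or_ae_notMem hE hinv with h | h
  · exact h
  exfalso
  have hstep : ∀ n, 0 ≤ ∫ z, max (g z) (-birkhoffMax T g n (T z)) ∂ρ := by
    intro n
    have h1 : ∀ z, max (g z) (-birkhoffMax T g n (T z)) =
        birkhoffMax T g (n + 1) z - birkhoffMax T g n (T z) := by
      intro z
      rw [birkhoffMax_succ, max_comm, sub_eq_add_neg, ← max_add_add_right]
      congr 1 <;> ring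
    have h2 : ∫ z, birkhoffMax T g n (T z) ∂ρ = ∫ z, birkhoffMax T g n z ∂ρ := by
      conv_rhs => rw [← hT.toMeasurePreserving.map_eq]
      rw [integral_map hT.measurable.aemeasurable (hmeas n).aestronglyMeasurable]
    simp_rw [h1]
    have h3 : Integrable (fun z => birkhoffMax T g n (T z)) ρ :=
      hT.toMeasurePreserving.integrable_comp_of_integrable (hint n)
    rw [integral_sub (hint _) h3, h2, sub_nonneg]
    exact integral_mono (hint _) (hint _) fun z => birkhoffMax_mono T g z n.le_succ
  have hlim : Tendsto (fun n => ∫ z, max (g z) (-birkhoffMax T g n (T z)) ∂ρ) atTop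
      (𝓝 (∫ z, g z ∂ρ)) := by
    refine tendsto_integral_of_dominated_convergence (fun _ => C) ?_ (integrable_const C) ?_ ?_
    · exact fun n => (hg.max ((hmeas n).comp hT.measurable).neg).aestronglyMeasurable
    · refine fun n => ae_of_all _ fun z => ?_
      have h1 := abs_le.1 (hC z)
      have h2 := birkhoffMax_nonneg T g n (T z)
      rw [Real.norm_eq_abs, abs_le]
      exact ⟨h1.1.trans (le_max_left _ _), max_le h1.2 (by linarith)⟩
    · filter_upwards [h] with z hz
      replace hz : ¬BddAbove (range fun n => birkhoffMax T g n (T z)) := fun h =>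
        hz ((bddAbove_birkhoffMax_iff T g z).1 h)
      have ht := tendsto_atTop_atTop_of_monotone' (birkhoffMax_mono T g (T z)) hz
      refine tendsto_const_nhds.congr' ?_
      filter_upwards [ht.eventually_ge_atTop (-g z)] with n hn
      rw [max_eq_left (by linarith)]
  exact hneg.not_ge (ge_of_tendsto' hlim hstep)

/-- The function `f - (I + η / 2)` has negative mean, so its Birkhoff sums are bounded above almost
everywhere; division by `n` absorbs the bound in the other `η / 2`. -/
theorem ae_eventually_birkhoffAverage_le [IsProbabilityMeasure ρ] {T : Z → Z} (hT : Ergodic T ρ)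
    {f : Z → ℝ} (hf : Measurable f) {C : ℝ} (hC : ∀ z, |f z| ≤ C) {η : ℝ} (hη : 0 < η) :
    ∀ᵐ z ∂ρ, ∀ᶠ n : ℕ in atTop, birkhoffAverage ℝ T f n z ≤ ∫ z, f z ∂ρ + η := by
  set I := ∫ z, f z ∂ρ with hI
  have hfi : Integrable f ρ := Integrable.of_bound hf.aestronglyMeasurable C (ae_of_all _ hC)
  have key := ae_bddAbove_birkhoffMax hT (g := fun z => f z - (I + η / 2))
    (hf.sub measurable_const) (C := C + |I + η / 2|)
    (fun z => (abs_sub _ _).trans (add_le_add_left (hC z) _)) (by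
      rw [integral_sub hfi (integrable_const _)]
      simp only [integral_const, probReal_univ, smul_eq_mul, one_mul]
      linarith)
  filter_upwards [key] with z ⟨b, hb⟩
  have h1 : ∀ n : ℕ, birkhoffSum T f n z ≤ n * (I + η / 2) + b := by
    intro n
    have h2 := (birkhoffSum_le_birkhoffMax T _ n z).trans (hb ⟨n, rfl⟩)
    simp only [birkhoffSum, Finset.sum_sub_distrib, Finset.sum_const, Finset.card_range,
      nsmul_eq_mul] at h2 ⊢
    linarith
  have h2 : Tendsto (fun n : ℕ => b / (n : ℝ)) atTop (𝓝 0) :=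
    tendsto_const_div_atTop_nhds_zero_nat b
  filter_upwards [h2.eventually_le_const (half_pos hη), eventually_gt_atTop 0] with n hn hn0
  have hn0' : (0 : ℝ) < n := by exact_mod_cast hn0
  rw [birkhoffAverage, smul_eq_mul, inv_mul_le_iff₀ hn0']
  rw [div_le_iff₀ hn0'] at hn
  have := h1 n
  nlinarith

/-- Birkhoff's pointwise ergodic theorem for bounded functions. -/
theorem Ergodic.ae_tendsto_birkhoffAverage [IsProbabilityMeasure ρ] {T : Z → Z} (hT : Ergodic T ρ)
    {f : Z → ℝ} (hf : Measurable f) {C : ℝ} (hC : ∀ z, |f z| ≤ C) :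
    ∀ᵐ z ∂ρ, Tendsto (fun n => birkhoffAverage ℝ T f n z) atTop (𝓝 (∫ z, f z ∂ρ)) := by
  have h1 := fun m : ℕ => ae_eventually_birkhoffAverage_le hT hf hC (η := 1 / ((m : ℝ) + 1))
    Nat.one_div_pos_of_nat
  have h2 := fun m : ℕ => ae_eventually_birkhoffAverage_le hT (f := fun z => -f z) hf.neg (C := C)
    (fun z => by simpa using hC z) (η := 1 / ((m : ℝ) + 1)) Nat.one_div_pos_of_nat
  filter_upwards [ae_all_iff.2 h1, ae_all_iff.2 h2] with z hz1 hz2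
  rw [Metric.tendsto_atTop']
  intro ε hε
  obtain ⟨m, hm⟩ := exists_nat_one_div_lt hε
  obtain ⟨n₀, hn₀⟩ := eventually_atTop.1 ((hz1 m).and (hz2 m))
  refine ⟨n₀, fun n hn => ?_⟩
  obtain ⟨h3, h4⟩ := hn₀ n hn.le
  have h5 : birkhoffAverage ℝ T (fun z => -f z) n z = -birkhoffAverage ℝ T f n z := by
    simp [birkhoffAverage, birkhoffSum]
  rw [h5, integral_neg] at h4
  rw [Real.dist_eq, abs_lt]
  constructor <;> linarith

end Birkhoff

theorem ae_eq_of_forall_intervalIntegral_eq {c d : ℝ → ℝ} (hc : LocallyIntegrable c)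
    (hd : LocallyIntegrable d) (h : ∀ b, ∫ u in (0 : ℝ)..b, c u = ∫ u in (0 : ℝ)..b, d u) :
    c =ᵐ[volume] d := by
  filter_upwards [LocallyIntegrable.ae_hasDerivAt_integral hc,
    LocallyIntegrable.ae_hasDerivAt_integral hd] with u h1 h2
  have h3 := h1 0
  simp_rw [h] at h3
  exact h3.unique (h2 0)

/-! ### Averages along the orbits of a flow -/

section FlowIntegral

variable {Z : Type*} [AddAction ℝ Z]

/-- The integral `∫₀ᵇ f (S_u z) du` of `f` along the orbit of `z`. -/
noncomputable def flowIntegral (f : Z → ℝ) (b : ℝ) (z : Z) : ℝ :=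
  ∫ u in (0 : ℝ)..b, f (u +ᵥ z)

theorem flowIntegral_zero (f : Z → ℝ) (z : Z) : flowIntegral f 0 z = 0 :=
  intervalIntegral.integral_same

variable {f : Z → ℝ} {C : ℝ}

theorem flowIntegral_vadd_of_invariant {s : ℝ} (hs : ∀ z, f (s +ᵥ z) = f z) (b : ℝ) (z : Z) :
    flowIntegral f b (s +ᵥ z) = flowIntegral f b z := by
  refine intervalIntegral.integral_congr fun u _ => ?_
  simp only [← add_vadd]
  rw [add_comm, add_vadd, hs]

variable [MeasurableSpace Z] [MeasurableVAdd₂ ℝ Z]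

theorem intervalIntegrable_flow (hf : Measurable f) (hC : ∀ z, |f z| ≤ C) (z : Z) (a b : ℝ) :
    IntervalIntegrable (fun u : ℝ => f (u +ᵥ z)) volume a b :=
  (intervalIntegrable_const (c := C)).mono_fun
    (hf.comp (measurable_vadd_const z)).aestronglyMeasurable
    (ae_of_all _ fun u => by
      simpa only [Real.norm_eq_abs] using (hC _).trans (le_abs_self C))

theorem measurable_flowIntegral (hf : Measurable f) (b : ℝ) : Measurable (flowIntegral f b) := by
  have h : StronglyMeasurable (Function.uncurry fun (z : Z) (u : ℝ) => f (u +ᵥ z)) :=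
    (hf.comp (measurable_snd.vadd measurable_fst)).stronglyMeasurable
  exact (h.integral_prod_right.sub h.integral_prod_right).measurable

theorem abs_flowIntegral_sub_le (hf : Measurable f) (hC : ∀ z, |f z| ≤ C) (a b : ℝ) (z : Z) :
    |flowIntegral f b z - flowIntegral f a z| ≤ C * |b - a| := by
  rw [flowIntegral, flowIntegral, intervalIntegral.integral_interval_sub_left
    (intervalIntegrable_flow hf hC z _ _) (intervalIntegrable_flow hf hC z _ _),
    ← Real.norm_eq_abs]
  exact intervalIntegral.norm_integral_le_of_norm_le_const fun u _ => hC _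

theorem abs_flowIntegral_le (hf : Measurable f) (hC : ∀ z, |f z| ≤ C) (b : ℝ) (z : Z) :
    |flowIntegral f b z| ≤ C * |b| := by
  simpa [flowIntegral_zero] using abs_flowIntegral_sub_le hf hC 0 b z

theorem flowIntegral_vadd (hf : Measurable f) (hC : ∀ z, |f z| ≤ C) (b t : ℝ) (z : Z) :
    flowIntegral f b (t +ᵥ z) = flowIntegral f (b + t) z - flowIntegral f t z := by
  rw [flowIntegral, flowIntegral, flowIntegral, intervalIntegral.integral_interval_sub_left
    (intervalIntegrable_flow hf hC z _ _) (intervalIntegrable_flow hf hC z _ _)]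
  simp_rw [← add_vadd]
  rw [intervalIntegral.integral_comp_add_right (fun u => f (u +ᵥ z)), zero_add]

theorem abs_flowIntegral_vadd_sub_le (hf : Measurable f) (hC : ∀ z, |f z| ≤ C) (b s t : ℝ) (z : Z) :
    |flowIntegral f b (t +ᵥ z) - flowIntegral f b (s +ᵥ z)| ≤ 2 * C * |t - s| := by
  rw [flowIntegral_vadd hf hC, flowIntegral_vadd hf hC]
  have h1 := abs_flowIntegral_sub_le hf hC (b + s) (b + t) z
  have h2 := abs_flowIntegral_sub_le hf hC s t z
  rw [add_sub_add_left_eq_sub] at h1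
  rw [abs_le] at h1 h2 ⊢
  constructor <;> linarith [h1.1, h1.2, h2.1, h2.2]

theorem flowIntegral_period_vadd (hf : Measurable f) (hC : ∀ z, |f z| ≤ C) {s : ℝ}
    (hs : ∀ z, f (s +ᵥ z) = f z) (t : ℝ) (z : Z) :
    flowIntegral f s (t +ᵥ z) = flowIntegral f s z := by
  have hper : Function.Periodic (fun u : ℝ => f (u +ᵥ z)) s := fun u => by
    simp only
    rw [add_comm, add_vadd, hs]
  have := hper.intervalIntegral_add_eq t 0
  rw [zero_add] at this
  rw [flowIntegral_vadd hf hC, flowIntegral, flowIntegral,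
    intervalIntegral.integral_interval_sub_left
    (intervalIntegrable_flow hf hC z _ _) (intervalIntegrable_flow hf hC z _ _), add_comm s t, this,
    flowIntegral]

theorem integral_flowIntegral_mul {W : Type*} [MeasurableSpace W] {ρ : Measure W}
    [IsFiniteMeasure ρ] (hf : Measurable f) (hC : ∀ z, |f z| ≤ C) {π : W → Z} (hπ : Measurable π)
    {g : W → ℝ} (hg : Measurable g) {D : ℝ} (hD : ∀ w, |g w| ≤ D) (b : ℝ) :
    ∫ w, flowIntegral f b (π w) * g w ∂ρ = ∫ u in (0 : ℝ)..b, ∫ w, f (u +ᵥ π w) * g w ∂ρ := by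
  rw [intervalIntegral_integral_swap]
  · simp only [flowIntegral, intervalIntegral.integral_mul_const]
  · have hm : Measurable (Function.uncurry fun (u : ℝ) (w : W) => f (u +ᵥ π w) * g w) :=
      (hf.comp (measurable_fst.vadd (hπ.comp measurable_snd))).mul (hg.comp measurable_snd)
    have : IsFiniteMeasure (volume.restrict (uIoc 0 b)) := by
      rw [uIoc]
      infer_instance
    refine Integrable.of_bound hm.aestronglyMeasurable (C * D) (ae_of_all _ fun p => ?_)
    rw [Real.norm_eq_abs, Function.uncurry_apply_pair, abs_mul]
    exact mul_le_mul (hC _) (hD _) (abs_nonneg _) ((abs_nonneg _).trans (hC (π p.2)))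

theorem locallyIntegrable_flow (hf : Measurable f) (hC : ∀ z, |f z| ≤ C) (z : Z) :
    LocallyIntegrable (fun u : ℝ => f (u +ᵥ z)) :=
  (locallyIntegrable_const C).mono (hf.comp (measurable_vadd_const z)).aestronglyMeasurable
    (ae_of_all _ fun u => by simpa only [Real.norm_eq_abs] using (hC _).trans (le_abs_self C))

end FlowIntegral

/-! ### Ergodicity of the time-`s` maps of an ergodic flow -/

section TimeMaps

variable {Z : Type*} [MeasurableSpace Z] [AddAction ℝ Z] {ρ : Measure Z} {f g : Z → ℝ} {C D : ℝ}

theorem ae_eq_const_of_flow_invariant [ErgodicVAdd ℝ Z ρ] (hf : Measurable f)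
    (h : ∀ (t : ℝ) z, f (t +ᵥ z) = f z) : ∃ c, f =ᵐ[ρ] fun _ => c := by
  refine exists_eventuallyEq_const_of_forall_separating MeasurableSet fun U hU => ?_
  have := aeconst_of_forall_preimage_vadd_ae_eq ℝ (μ := ρ) (hf hU).nullMeasurableSet
    (fun t => by
      have : (t +ᵥ ·) ⁻¹' (f ⁻¹' U) = f ⁻¹' U := by ext z; simp [h]
      exact .of_eq this)
  exact eventuallyConst_set.1 this

variable [MeasurableVAdd₂ ℝ Z]

/-- Rational `b` suffice by continuity. Differentiation in `b` gives `f (u +ᵥ z) = 0` for almost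
every `u`, Fubini yields one `u` good for almost every `z`, and invariance of `ρ` removes the shift
by `u`. -/
theorem ae_eq_zero_of_forall_flowIntegral_ae_eq_zero [IsFiniteMeasure ρ]
    [VAddInvariantMeasure ℝ Z ρ] (hf : Measurable f) (hC : ∀ z, |f z| ≤ C)
    (h : ∀ b, flowIntegral f b =ᵐ[ρ] 0) : f =ᵐ[ρ] 0 := by
  have h1 : ∀ᵐ z ∂ρ, ∀ᵐ u : ℝ, f (u +ᵥ z) = 0 := by
    filter_upwards [ae_all_iff.2 fun q : ℚ => h q] with z hz
    have hcont : Continuous fun b => flowIntegral f b z :=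
      intervalIntegral.continuous_primitive (fun a b => intervalIntegrable_flow hf hC z a b) 0
    have hz' : (fun b => flowIntegral f b z) = fun _ => 0 :=
      hcont.ext_on Rat.isDenseEmbedding_coe_real.dense continuous_const
        (by rintro _ ⟨q, rfl⟩; exact hz q)
    refine ae_eq_of_forall_intervalIntegral_eq (locallyIntegrable_flow hf hC z)
      (locallyIntegrable_const 0) fun b => ?_
    rw [intervalIntegral.integral_zero]
    exact congrFun hz' b
  have hm : MeasurableSet {p : Z × ℝ | f (p.2 +ᵥ p.1) = 0} :=
    (hf.comp (measurable_snd.vadd measurable_fst)) (measurableSet_singleton 0)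
  obtain ⟨u, hu⟩ := (Measure.ae_ae_comm hm).1 h1 |>.exists
  have hp := (measurePreserving_vadd (-u) ρ).quasiMeasurePreserving.ae hu
  filter_upwards [hp] with z hz
  simpa using hz

/-- The integral of an `s`-periodic function over a full period does not depend on the starting
point. It is therefore flow invariant, hence constant, and its mean is zero. -/
theorem flowIntegral_period_ae_eq_zero [IsProbabilityMeasure ρ] [ErgodicVAdd ℝ Z ρ]
    (hf : Measurable f) (hC : ∀ z, |f z| ≤ C) {s : ℝ} (hs : ∀ z, f (s +ᵥ z) = f z)
    (h0 : ∫ z, f z ∂ρ = 0) : flowIntegral f s =ᵐ[ρ] 0 := by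
  obtain ⟨c, hc⟩ := ae_eq_const_of_flow_invariant (ρ := ρ) (measurable_flowIntegral hf s)
    (flowIntegral_period_vadd hf hC hs)
  have h1 : ∫ z, flowIntegral f s z ∂ρ = c := by
    rw [integral_congr_ae hc]
    simp
  have h2 := integral_flowIntegral_mul (ρ := ρ) hf hC measurable_id (g := fun _ => 1)
    measurable_const (D := 1) (by simp) s
  have h3 : ∀ u : ℝ, ∫ z, f (u +ᵥ z) ∂ρ = 0 := fun u => by
    rw [← h0]
    exact (measurePreserving_vadd u ρ).integral_comp (measurableEmbedding_const_vadd u) f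
  simp only [id, mul_one, h3, intervalIntegral.integral_zero] at h2
  rw [h2] at h1
  rw [← h1] at hc
  exact hc

theorem integral_flowIntegral_eq_zero [IsProbabilityMeasure ρ] [ErgodicVAdd ℝ Z ρ]
    (hf : Measurable f) (hC : ∀ z, |f z| ≤ C) (h0 : ∫ z, f z ∂ρ = 0) (b : ℝ) :
    ∫ z, flowIntegral f b z ∂ρ = 0 := by
  have h2 := integral_flowIntegral_mul (ρ := ρ) hf hC measurable_id (g := fun _ => 1)
    measurable_const (D := 1) (by simp) b
  have h3 : ∀ u : ℝ, ∫ z, f (u +ᵥ z) ∂ρ = 0 := fun u => by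
    rw [← h0]
    exact (measurePreserving_vadd u ρ).integral_comp (measurableEmbedding_const_vadd u) f
  simpa only [id, mul_one, h3, intervalIntegral.integral_zero] using h2

/-- The correlation `c t` of the translated orbit integral with `g` has both `s` and `s'` as
periods. It is continuous, which is why `f` is replaced by its orbit integral: the flow is only
measurable. Irrationality makes the periods dense, so `c` is constant; its integral over `[0, s]`
vanishes by `flowIntegral_period_ae_eq_zero`. -/
theorem integral_flowIntegral_mul_eq_zero_of_irrational [IsProbabilityMeasure ρ]
    [ErgodicVAdd ℝ Z ρ] (hf : Measurable f) (hC : ∀ z, |f z| ≤ C) (hg : Measurable g)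
    (hD : ∀ z, |g z| ≤ D) {s s' : ℝ} (hs : ∀ z, f (s +ᵥ z) = f z)
    (hs' : ∀ z, g (s' +ᵥ z) = g z) (hirr : Irrational (s / s')) (h0 : ∫ z, f z ∂ρ = 0) (b : ℝ) :
    ∫ z, flowIntegral f b z * g z ∂ρ = 0 := by
  have hs0 : s ≠ 0 := by rintro rfl; simp at hirr
  have hFm := measurable_flowIntegral hf b
  have hFb := abs_flowIntegral_le hf hC b
  have hFs : ∀ z, flowIntegral f b (s +ᵥ z) = flowIntegral f b z :=
    flowIntegral_vadd_of_invariant hs b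
  obtain ⟨z₀⟩ : Nonempty Z := nonempty_of_isProbabilityMeasure ρ
  have hC0 : 0 ≤ C := (abs_nonneg _).trans (hC z₀)
  have hD0 : 0 ≤ D := (abs_nonneg _).trans (hD z₀)
  set c : ℝ → ℝ := fun t => ∫ z, flowIntegral f b (t +ᵥ z) * g z ∂ρ with hc
  have hint : ∀ t : ℝ, Integrable (fun z => flowIntegral f b (t +ᵥ z) * g z) ρ := fun t =>
    Integrable.of_bound ((hFm.comp (measurable_const_vadd t)).mul hg).aestronglyMeasurable
      (C * |b| * D) (ae_of_all _ fun z => by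
        rw [Real.norm_eq_abs, abs_mul]
        exact mul_le_mul (hFb _) (hD _) (abs_nonneg _) (by positivity))
  have hcont : Continuous c := by
    refine (LipschitzWith.of_dist_le_mul (K := (2 * C * D).toNNReal) fun t t' => ?_).continuous
    rw [Real.dist_eq, Real.dist_eq, hc]
    simp only
    rw [← integral_sub (hint t) (hint t'), Real.coe_toNNReal _ (by positivity), ← Real.norm_eq_abs]
    refine (norm_integral_le_of_norm_le_const (C := 2 * C * D * |t - t'|)
      (ae_of_all _ fun z => ?_)).trans (by simp)
    rw [← sub_mul, Real.norm_eq_abs, abs_mul, mul_right_comm]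
    exact mul_le_mul (abs_flowIntegral_vadd_sub_le hf hC b t' t z) (hD z) (abs_nonneg _)
      (by positivity)
  have hper : Function.Periodic c s := fun t => by
    simp only [hc]
    refine integral_congr_ae (ae_of_all _ fun z => ?_)
    simp only
    rw [add_comm, add_vadd, hFs]
  have hper' : Function.Periodic c s' := fun t => by
    simp only [hc]
    rw [← (measurePreserving_vadd s' ρ).integral_comp (measurableEmbedding_const_vadd s')
      (fun z => flowIntegral f b (t +ᵥ z) * g z)]
    simp only [hs', add_vadd]
  have hdense := dense_addSubgroupClosure_pair_iff.2 hirr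
  have hconst : ∀ t, c t = c 0 := by
    have : c = fun _ => c 0 := by
      refine hcont.ext_on hdense continuous_const fun t ht => ?_
      have : Function.Periodic c t := by
        induction ht using AddSubgroup.closure_induction with
        | mem x hx =>
          rcases hx with rfl | rfl
          · exact hper
          · exact hper'
        | zero => exact fun t => by rw [add_zero]
        | add x y _ _ hx hy => exact hx.add_period hy
        | neg x _ hx => exact hx.neg
      simpa using this 0
    exact congrFun this
  have hz := flowIntegral_period_ae_eq_zero (ρ := ρ) hFm hFb hFs
    (integral_flowIntegral_eq_zero hf hC h0 b)
  have h1 := integral_flowIntegral_mul (ρ := ρ) hFm hFb measurable_id hg hD s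
  have h2 : ∫ u in (0 : ℝ)..s, c u = 0 := by
    rw [hc]
    simp only [id] at h1
    rw [← h1, integral_eq_zero_of_ae]
    filter_upwards [hz] with z hz'
    simp [hz']
  simp_rw [hconst] at h2
  rw [intervalIntegral.integral_const, smul_eq_mul, sub_zero] at h2
  have h3 := (mul_eq_zero.1 h2).resolve_left hs0
  simpa [hc] using h3

/-- If the time-`s` map of an ergodic flow is not ergodic, then there is a bounded function of mean
zero which is invariant under this map and some of whose averages along orbits are nonzero. -/
theorem exists_invariant_of_not_ergodic [IsProbabilityMeasure ρ] [VAddInvariantMeasure ℝ Z ρ]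
    {s : ℝ} (hs : ¬Ergodic (fun z : Z => s +ᵥ z) ρ) :
    ∃ (f : Z → ℝ) (b : ℝ), Measurable f ∧ (∀ z, |f z| ≤ 1) ∧ (∀ z, f (s +ᵥ z) = f z) ∧
      ∫ z, f z ∂ρ = 0 ∧ ¬flowIntegral f b =ᵐ[ρ] 0 := by
  have h1 : ∃ A : Set Z, MeasurableSet A ∧ (fun z : Z => s +ᵥ z) ⁻¹' A = A ∧
      ¬EventuallyConst A (ae ρ) := by
    by_contra! hcon
    exact hs ⟨measurePreserving_vadd s ρ, ⟨fun A hA h => hcon A hA h⟩⟩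
  obtain ⟨A, hA, hinv, hne⟩ := h1
  set f : Z → ℝ := fun z => A.indicator 1 z - ρ.real A with hf
  have hfm : Measurable f := (measurable_one.indicator hA).sub measurable_const
  have hr0 : 0 ≤ ρ.real A := measureReal_nonneg
  have hr1 : ρ.real A ≤ 1 := measureReal_le_one
  have hb : ∀ z, |f z| ≤ 1 := fun z => by
    rw [hf, abs_le]
    by_cases hz : z ∈ A <;> simp [hz] <;> linarith
  have hfs : ∀ z, f (s +ᵥ z) = f z := fun z => by
    have : s +ᵥ z ∈ A ↔ z ∈ A := by rw [← mem_preimage (f := fun z : Z => s +ᵥ z), hinv]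
    by_cases hz : z ∈ A
    · simp [hf, hz, this.2 hz]
    · simp [hf, hz, mt this.1 hz]
  have h0 : ∫ z, f z ∂ρ = 0 := by
    rw [hf, integral_sub ((integrable_const 1).indicator hA) (integrable_const _),
      integral_indicator_one hA]
    simp
  by_contra! hcon
  have hz := ae_eq_zero_of_forall_flowIntegral_ae_eq_zero (ρ := ρ) hfm hb
    fun b => hcon f b hfm hb hfs h0
  refine hne (eventuallyConst_set.2 ?_)
  by_cases hr : ρ.real A = 0
  · right
    filter_upwards [hz] with z hz' hzA
    simp [hf, hr, hzA] at hz'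
  · left
    filter_upwards [hz] with z hz'
    by_contra hzA
    simp [hf, hzA] at hz'
    exact hr hz'

/-- The time-`s` map of an ergodic flow is ergodic for all but countably many `s`. -/
theorem countable_setOf_not_ergodic [IsProbabilityMeasure ρ] [ErgodicVAdd ℝ Z ρ]
    [MeasurableSpace.CountablyGenerated Z] :
    {s : ℝ | ¬Ergodic (fun z : Z => s +ᵥ z) ρ}.Countable := by
  -- Serves the separability of `L²`, which rests on countable generation.
  have : Fact ((2 : ℝ≥0∞) ≠ ∞) := ⟨by simp⟩
  choose! f b hfm hf1 hfs hf0 hfb using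
    fun (s : ℝ) (hs : ¬Ergodic (fun z : Z => s +ᵥ z) ρ) => exists_invariant_of_not_ergodic hs
  set B := {s : ℝ | ¬Ergodic (fun z : Z => s +ᵥ z) ρ} with hB
  have hmem : ∀ s : B, MemLp (flowIntegral (f s) (b s)) 2 ρ := fun s =>
    MemLp.of_bound (measurable_flowIntegral (hfm s s.2) _).aestronglyMeasurable (1 * |b s|)
      (ae_of_all _ (abs_flowIntegral_le (hfm s s.2) (hf1 s s.2) (b s)))
  set v : B → Lp ℝ 2 ρ := fun s => (hmem s).toLp with hv
  have hv0 : ∀ s, v s ≠ 0 := fun s h => hfb s s.2 (by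
    have h1 := (hmem s).coeFn_toLp
    rw [show (hmem s).toLp = 0 from h] at h1
    exact h1.symm.trans (Lp.coeFn_zero ℝ 2 ρ))
  have horth : ∀ s s' : B, Irrational (s / s' : ℝ) → inner ℝ (v s) (v s') = 0 := by
    intro s s' hirr
    rw [L2.inner_def, ← integral_flowIntegral_mul_eq_zero_of_irrational (ρ := ρ) (hfm s s.2)
      (hf1 s s.2) (measurable_flowIntegral (hfm s' s'.2) (b s'))
      (abs_flowIntegral_le (hfm s' s'.2) (hf1 s' s'.2) (b s')) (hfs s s.2)
      (flowIntegral_vadd_of_invariant (hfs s' s'.2) (b s')) hirr (hf0 s s.2) (b s)]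
    refine integral_congr_ae ?_
    filter_upwards [(hmem s).coeFn_toLp, (hmem s').coeFn_toLp] with z h1 h2
    rw [h1, h2]
    simp [mul_comm]
  set e : B → Lp ℝ 2 ρ := fun s => ‖v s‖⁻¹ • v s with he
  have he1 : ∀ s, ‖e s‖ = 1 := fun s => by
    rw [he, norm_smul, norm_inv, norm_norm, inv_mul_cancel₀ (norm_ne_zero_iff.2 (hv0 s))]
  have hdist : ∀ s s' : B, Irrational (s / s' : ℝ) → 1 ≤ dist (e s) (e s') := by
    intro s s' hirr
    have h1 : inner ℝ (e s) (e s') = 0 := by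
      simp [he, inner_smul_left, inner_smul_right, horth s s' hirr]
    have h2 := norm_sub_sq_real (e s) (e s')
    rw [h1, he1, he1] at h2
    rw [dist_eq_norm]
    nlinarith [norm_nonneg (e s - e s')]
  -- Two unit vectors close to the same dense point are less than `1` apart, so their times have
  -- rational ratio: each `E n` lies in the rational multiples of one number.
  set E : ℕ → Set B := fun n =>
    {s : B | (s : ℝ) ≠ 0 ∧ dist (e s) (TopologicalSpace.denseSeq _ n) < 1 / 2} with hE
  have hcover : B ⊆ {0} ∪ ⋃ n, (↑) '' E n := by
    intro s hs
    rcases eq_or_ne s 0 with h0 | h0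
    · exact Or.inl h0
    obtain ⟨n, hn⟩ := (TopologicalSpace.denseRange_denseSeq (Lp ℝ 2 ρ)).exists_dist_lt
      (e ⟨s, hs⟩) (half_pos one_pos)
    exact Or.inr (mem_iUnion.2 ⟨n, ⟨s, hs⟩, ⟨h0, hn⟩, rfl⟩)
  refine ((countable_singleton 0).union (countable_iUnion fun n => ?_)).mono hcover
  rcases eq_empty_or_nonempty (E n) with h | ⟨s', h0', hs'⟩
  · rw [h]
    simp
  refine (countable_range fun q : ℚ => (q : ℝ) * s').mono ?_
  rintro _ ⟨s, ⟨_, hs⟩, rfl⟩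
  by_contra hcon
  have hirr : Irrational (s / s' : ℝ) := by
    rintro ⟨q, hq⟩
    exact hcon ⟨q, by simp [hq, h0']⟩
  have := hdist s s' hirr
  have := dist_triangle_right (e s) (e s') (TopologicalSpace.denseSeq _ n)
  linarith

end TimeMaps

/-! ### Translations of the first coordinate which preserve a joining -/

/-- The real numbers `t` for which every function `J i` satisfies `J i (b + t) = J i b + J i t`. -/
def additivityGroup {ι : Type*} (J : ι → ℝ → ℝ) (h0 : ∀ i, J i 0 = 0) : AddSubgroup ℝ where
  carrier := {t | ∀ i b, J i (b + t) = J i b + J i t}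
  zero_mem' := fun i b => by rw [h0, add_zero, add_zero]
  add_mem' := fun {s t} hs ht i b => by
    rw [← add_assoc, ht i (b + s), hs i b, ht i s, add_assoc]
  neg_mem' := fun {t} ht i b => by
    have h1 := ht i (b + -t)
    have h2 := ht i (-t)
    rw [neg_add_cancel_right] at h1
    rw [neg_add_cancel, h0] at h2
    linarith

theorem mem_additivityGroup {ι : Type*} {J : ι → ℝ → ℝ} {h0 : ∀ i, J i 0 = 0} {t : ℝ} :
    t ∈ additivityGroup J h0 ↔ ∀ i b, J i (b + t) = J i b + J i t := Iff.rfl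

/-- Continuity makes the subgroup closed, and a closed subgroup of `ℝ` is everything or cyclic. -/
theorem additivityGroup_eq_top_or_countable {ι : Type*} {J : ι → ℝ → ℝ} (h0 : ∀ i, J i 0 = 0)
    (hJ : ∀ i, Continuous (J i)) :
    additivityGroup J h0 = ⊤ ∨ (additivityGroup J h0 : Set ℝ).Countable := by
  have hclosed : IsClosed (additivityGroup J h0 : Set ℝ) := by
    have : (additivityGroup J h0 : Set ℝ) = ⋂ i, ⋂ b, {t | J i (b + t) = J i b + J i t} := by
      ext t
      simp [mem_additivityGroup]
    rw [this]
    exact isClosed_iInter fun i => isClosed_iInter fun b =>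
      isClosed_eq ((hJ i).comp (continuous_const.add continuous_id)) (continuous_const.add (hJ i))
  rcases (additivityGroup J h0).dense_or_cyclic with h | ⟨a, ha⟩
  · left
    rw [← SetLike.coe_set_eq, ← hclosed.closure_eq, h.closure_eq, AddSubgroup.coe_top]
  · right
    rw [ha, ← AddSubgroup.zmultiples_eq_closure]
    exact countable_range _

/-- A countable algebra of sets generating a countably generated σ-algebra. -/
def countableAlgebra (α : Type*) [MeasurableSpace α] [MeasurableSpace.CountablyGenerated α] :
    Set (Set α) :=
  generateSetAlgebra (MeasurableSpace.countableGeneratingSet α)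

section CountableAlgebra

variable {α β : Type*} [MeasurableSpace α] [MeasurableSpace.CountablyGenerated α]
  [MeasurableSpace β] [MeasurableSpace.CountablyGenerated β]

instance : Countable (countableAlgebra α) :=
  (countable_generateSetAlgebra
    (MeasurableSpace.countable_countableGeneratingSet (α := α))).to_subtype

theorem generateFrom_countableAlgebra :
    MeasurableSpace.generateFrom (countableAlgebra α) = ‹MeasurableSpace α› :=
  generateFrom_generateSetAlgebra_eq.trans MeasurableSpace.generateFrom_countableGeneratingSet

theorem isSetAlgebra_countableAlgebra : IsSetAlgebra (countableAlgebra α) :=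
  isSetAlgebra_generateSetAlgebra

theorem measurableSet_of_mem_countableAlgebra {A : Set α} (hA : A ∈ countableAlgebra α) :
    MeasurableSet A := by
  rw [← generateFrom_countableAlgebra (α := α)]
  exact MeasurableSpace.measurableSet_generateFrom hA

theorem isCountablySpanning_countableAlgebra : IsCountablySpanning (countableAlgebra α) :=
  ⟨fun _ => univ, fun _ => isSetAlgebra_countableAlgebra.univ_mem, iUnion_const _⟩

theorem isPiSystem_countableAlgebra : IsPiSystem (countableAlgebra α) := fun _ hs _ ht _ =>
  isSetAlgebra_countableAlgebra.inter_mem hs ht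

theorem ext_of_countableAlgebra_prod {ρ₁ ρ₂ : Measure (α × β)} [IsFiniteMeasure ρ₁]
    (h : ∀ A ∈ countableAlgebra α, ∀ B ∈ countableAlgebra β, ρ₁ (A ×ˢ B) = ρ₂ (A ×ˢ B)) :
    ρ₁ = ρ₂ := by
  refine ext_of_generate_finite _ (generateFrom_eq_prod generateFrom_countableAlgebra
    generateFrom_countableAlgebra isCountablySpanning_countableAlgebra
    isCountablySpanning_countableAlgebra).symm
    (isPiSystem_countableAlgebra.prod isPiSystem_countableAlgebra) ?_ ?_
  · rintro _ ⟨A, hA, B, hB, rfl⟩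
    exact h A hA B hB
  · rw [← univ_prod_univ]
    exact h _ isSetAlgebra_countableAlgebra.univ_mem _ isSetAlgebra_countableAlgebra.univ_mem

end CountableAlgebra

/-! ### Orbit-averaged test functions and translates of a joining -/

section Translation

variable {X Y : Type*} [AddAction ℝ X]

/-- The function `(x, y) ↦ (∫₀ᵇ 1_A (S_u x) du) 1_B (y)`. -/
noncomputable def orbitTest (A : Set X) (B : Set Y) (b : ℝ) (w : X × Y) : ℝ :=
  flowIntegral (A.indicator 1) b w.1 * B.indicator 1 w.2

theorem orbitTest_zero (A : Set X) (B : Set Y) (w : X × Y) : orbitTest A B 0 w = 0 := by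
  rw [orbitTest, flowIntegral_zero, zero_mul]

theorem abs_indicator_one_le {α : Type*} (A : Set α) (x : α) :
    |A.indicator (1 : α → ℝ) x| ≤ 1 := by
  by_cases hx : x ∈ A <;> simp [hx]

variable [MeasurableSpace X] [MeasurableVAdd₂ ℝ X] {A : Set X} {B : Set Y}

theorem abs_orbitTest_sub_le (hA : MeasurableSet A) (b b' : ℝ) (w : X × Y) :
    |orbitTest A B b w - orbitTest A B b' w| ≤ |b - b'| := by
  rw [orbitTest, orbitTest, ← sub_mul, abs_mul]
  have h1 := abs_flowIntegral_sub_le (measurable_one.indicator hA) (abs_indicator_one_le A) b' b w.1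
  have h2 := abs_indicator_one_le B w.2
  rw [one_mul] at h1
  exact (mul_le_mul h1 h2 (abs_nonneg _) (abs_nonneg _)).trans_eq (mul_one _)

theorem abs_orbitTest_le (hA : MeasurableSet A) (b : ℝ) (w : X × Y) :
    |orbitTest A B b w| ≤ |b| := by
  simpa [orbitTest_zero] using abs_orbitTest_sub_le (B := B) hA b 0 w

/-- This identity motivates `orbitTest`: translates stay in the span of the family, and the family
depends continuously on `b`. One set of generic points of full measure thus serves all real `t`. -/
theorem orbitTest_vadd (hA : MeasurableSet A) (b t : ℝ) (x : X) (y : Y) :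
    orbitTest A B b (t +ᵥ x, y) = orbitTest A B (b + t) (x, y) - orbitTest A B t (x, y) := by
  simp only [orbitTest]
  rw [flowIntegral_vadd (measurable_one.indicator hA) (abs_indicator_one_le A), sub_mul]

variable [MeasurableSpace Y] {ρ : Measure (X × Y)}

theorem measurable_orbitTest (hA : MeasurableSet A) (hB : MeasurableSet B) (b : ℝ) :
    Measurable (orbitTest A B b) :=
  ((measurable_flowIntegral (measurable_one.indicator hA) b).comp measurable_fst).mul
    ((measurable_one.indicator hB).comp measurable_snd)

theorem integrable_orbitTest [IsFiniteMeasure ρ] (hA : MeasurableSet A) (hB : MeasurableSet B)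
    (b : ℝ) : Integrable (orbitTest A B b) ρ :=
  Integrable.of_bound (measurable_orbitTest hA hB b).aestronglyMeasurable |b|
    (ae_of_all _ (abs_orbitTest_le hA b))

theorem lipschitzWith_integral_orbitTest [IsProbabilityMeasure ρ] (hA : MeasurableSet A)
    (hB : MeasurableSet B) : LipschitzWith 1 fun b => ∫ w, orbitTest A B b w ∂ρ := by
  refine LipschitzWith.of_dist_le_mul fun b b' => ?_
  rw [Real.dist_eq, Real.dist_eq, ← integral_sub (integrable_orbitTest hA hB b)
    (integrable_orbitTest hA hB b'), ← Real.norm_eq_abs]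
  refine (norm_integral_le_of_norm_le_const (C := |b - b'|)
    (ae_of_all _ (abs_orbitTest_sub_le hA b b'))).trans ?_
  simp

/-- If all the integrals of the functions `orbitTest A B` are additive at `t`, then translation by
`t` in the first coordinate preserves the measure. -/
theorem map_vadd_fst_eq_of_additive [MeasurableSpace.CountablyGenerated X]
    [MeasurableSpace.CountablyGenerated Y] [IsFiniteMeasure ρ] {t : ℝ}
    (h : ∀ A ∈ countableAlgebra X, ∀ B ∈ countableAlgebra Y, ∀ b,
      ∫ w, orbitTest A B (b + t) w ∂ρ = ∫ w, orbitTest A B b w ∂ρ + ∫ w, orbitTest A B t w ∂ρ) :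
    ρ.map (fun w => (t +ᵥ w.1, w.2)) = ρ := by
  have hmeas : ∀ u : ℝ, Measurable fun w : X × Y => (u +ᵥ w.1, w.2) := fun u =>
    ((measurable_const_vadd u).comp measurable_fst).prodMk measurable_snd
  have hfib : ∀ {A : Set X} {B : Set Y}, MeasurableSet A → MeasurableSet B → ∀ u : ℝ,
      ∫ w, A.indicator (1 : X → ℝ) (u +ᵥ w.1) * B.indicator 1 w.2 ∂ρ =
        (ρ.map fun w => (u +ᵥ w.1, w.2)).real (A ×ˢ B) := by
    intro A B hA hB u
    rw [map_measureReal_apply (hmeas u) (hA.prod hB),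
      ← integral_indicator_one ((hmeas u) (hA.prod hB))]
    refine integral_congr_ae (ae_of_all _ fun w => ?_)
    by_cases h1 : u +ᵥ w.1 ∈ A <;> by_cases h2 : w.2 ∈ B <;> simp [h1, h2]
  -- The integral of `orbitTest A B b` is the primitive of `c`, so additivity at `t` says that `c`
  -- and its shift by `t` have the same primitive.
  have hae : ∀ (A : countableAlgebra X) (B : countableAlgebra Y), ∀ᵐ u : ℝ,
      (ρ.map fun w => ((u + t) +ᵥ w.1, w.2)).real (A.1 ×ˢ B.1) =
        (ρ.map fun w => (u +ᵥ w.1, w.2)).real (A.1 ×ˢ B.1) := by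
    rintro ⟨A, hA'⟩ ⟨B, hB'⟩
    have hA := measurableSet_of_mem_countableAlgebra hA'
    have hB := measurableSet_of_mem_countableAlgebra hB'
    set c : ℝ → ℝ := fun u => (ρ.map fun w => (u +ᵥ w.1, w.2)).real (A ×ˢ B) with hc
    have hcm : Measurable c := by
      have : StronglyMeasurable fun u : ℝ =>
          ∫ w, A.indicator (1 : X → ℝ) (u +ᵥ w.1) * B.indicator 1 w.2 ∂ρ := by
        refine StronglyMeasurable.integral_prod_right (f := fun (u : ℝ) (w : X × Y) =>
          A.indicator (1 : X → ℝ) (u +ᵥ w.1) * B.indicator 1 w.2) ?_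
        exact (((measurable_one.indicator hA).comp
          (measurable_fst.vadd (measurable_fst.comp measurable_snd))).mul
          ((measurable_one.indicator hB).comp
            (measurable_snd.comp measurable_snd))).stronglyMeasurable
      simp_rw [hfib hA hB] at this
      exact this.measurable
    have hcb : ∀ u, ‖c u‖ ≤ ρ.real univ := fun u => by
      rw [Real.norm_eq_abs, abs_of_nonneg measureReal_nonneg]
      rw [map_measureReal_apply (hmeas u) (hA.prod hB)]
      exact measureReal_mono (subset_univ _)
    have hcl : LocallyIntegrable c := (locallyIntegrable_const (ρ.real univ)).mono
      hcm.aestronglyMeasurable (ae_of_all _ fun u => (hcb u).trans (le_abs_self _))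
    have hct : LocallyIntegrable fun u => c (u + t) :=
      (locallyIntegrable_const (ρ.real univ)).mono
        (hcm.comp (measurable_add_const t)).aestronglyMeasurable
        (ae_of_all _ fun u => (hcb _).trans (le_abs_self _))
    have hI : ∀ b, ∫ w, orbitTest A B b w ∂ρ = ∫ u in (0 : ℝ)..b, c u := by
      intro b
      have := integral_flowIntegral_mul (ρ := ρ) (measurable_one.indicator hA)
        (abs_indicator_one_le A) measurable_fst ((measurable_one.indicator hB).comp measurable_snd)
        (fun w => abs_indicator_one_le B w.2) b
      simp only [Function.comp_apply, hfib hA hB] at this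
      exact this
    have hci : ∀ a b, IntervalIntegrable c volume a b := fun a b =>
      (intervalIntegrable_const (c := ρ.real univ)).mono_fun hcm.aestronglyMeasurable
        (ae_of_all _ fun u => (hcb u).trans (le_abs_self _))
    refine ae_eq_of_forall_intervalIntegral_eq hct hcl fun b => ?_
    have h1 := h A hA' B hB' b
    rw [hI, hI, hI] at h1
    rw [intervalIntegral.integral_comp_add_right c, zero_add,
      ← intervalIntegral.integral_interval_sub_left (hci _ _) (hci _ _), h1, add_sub_cancel_right]
  -- Countability of the algebras gives one `u` for all rectangles; translation by `-u` then removes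
  -- it.
  obtain ⟨u, hu⟩ := (ae_all_iff.2 fun A => ae_all_iff.2 fun B => hae A B).exists
  have h1 : (ρ.map fun w => ((u + t) +ᵥ w.1, w.2)) = ρ.map fun w => (u +ᵥ w.1, w.2) :=
    ext_of_countableAlgebra_prod fun A hA B hB =>
      (measureReal_eq_measureReal_iff).1 (hu ⟨A, hA⟩ ⟨B, hB⟩)
  have h2 := congrArg (Measure.map fun w : X × Y => ((-u) +ᵥ w.1, w.2)) h1
  rw [Measure.map_map (hmeas _) (hmeas _), Measure.map_map (hmeas _) (hmeas _)] at h2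
  simpa [Function.comp_def, ← add_vadd] using h2

/-- A joining which is preserved by the translation by `p` in the first coordinate is the product
measure if this translation is ergodic. -/
theorem eq_prod_of_map_vadd_fst_eq {μ : Measure X} {ν : Measure Y} [IsProbabilityMeasure μ]
    [IsProbabilityMeasure ρ] (h1 : ρ.map Prod.fst = μ) (h2 : ρ.map Prod.snd = ν) {p : ℝ}
    (hp : Ergodic (fun x : X => p +ᵥ x) μ) (h : ρ.map (fun w => (p +ᵥ w.1, w.2)) = ρ) :
    ρ = μ.prod ν := by
  have hν : IsProbabilityMeasure ν :=
    h2 ▸ Measure.isProbabilityMeasure_map measurable_snd.aemeasurable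
  have hmeas : Measurable fun w : X × Y => (p +ᵥ w.1, w.2) :=
    ((measurable_const_vadd p).comp measurable_fst).prodMk measurable_snd
  refine (Measure.prod_eq fun A B hA hB => ?_).symm
  -- The slice `A ↦ ρ (A ×ˢ B)` is `S_p`-invariant and absolutely continuous, hence a multiple of
  -- the ergodic measure `μ`.
  set τ : Measure X := (ρ.restrict (Prod.snd ⁻¹' B)).map Prod.fst with hτ
  have hτA : ∀ A, MeasurableSet A → τ A = ρ (A ×ˢ B) := fun A hA => by
    rw [hτ, Measure.map_apply measurable_fst hA, Measure.restrict_apply (measurable_fst hA),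
      Set.prod_eq]
  have hac : τ ≪ μ := by
    rw [← h1, hτ]
    exact (Measure.map_mono Measure.restrict_le_self measurable_fst).absolutelyContinuous
  have hpres : MeasurePreserving (fun x : X => p +ᵥ x) τ τ := by
    refine ⟨measurable_const_vadd p, Measure.ext fun A hA => ?_⟩
    rw [Measure.map_apply (measurable_const_vadd p) hA, hτA A hA,
      hτA _ (measurable_const_vadd p hA)]
    conv_rhs => rw [← h, Measure.map_apply hmeas (hA.prod hB)]
    rfl
  obtain ⟨c, hc⟩ := hp.eq_smul_of_absolutelyContinuous hpres hac
  have hcB : c = ν B := by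
    have := hτA univ MeasurableSet.univ
    rw [hc, Measure.smul_apply, measure_univ, smul_eq_mul, mul_one] at this
    rw [this, ← h2, Measure.map_apply measurable_snd hB, univ_prod]
  rw [← hτA A hA, hc, hcB, Measure.smul_apply, smul_eq_mul, mul_comm]

/-- The translations of the first coordinate under which the integrals of the functions
`orbitTest A B b` are invariant. -/
noncomputable def translationGroup [MeasurableSpace.CountablyGenerated X]
    [MeasurableSpace.CountablyGenerated Y] (ρ : Measure (X × Y)) : AddSubgroup ℝ :=
  additivityGroup
    (fun (i : countableAlgebra X × countableAlgebra Y) b => ∫ w, orbitTest i.1.1 i.2.1 b w ∂ρ)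
    fun i => by simp [orbitTest, flowIntegral_zero]

theorem countable_translationGroup [MeasurableSpace.CountablyGenerated X]
    [MeasurableSpace.CountablyGenerated Y] {μ : Measure X} {ν : Measure Y}
    [IsProbabilityMeasure μ] [IsProbabilityMeasure ρ] (h1 : ρ.map Prod.fst = μ)
    (h2 : ρ.map Prod.snd = ν) {p : ℝ} (hp : Ergodic (fun x : X => p +ᵥ x) μ)
    (hne : ρ ≠ μ.prod ν) : (translationGroup ρ : Set ℝ).Countable := by
  refine (additivityGroup_eq_top_or_countable _ fun i => ?_).resolve_left fun h => hne ?_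
  · exact (lipschitzWith_integral_orbitTest (measurableSet_of_mem_countableAlgebra i.1.2)
      (measurableSet_of_mem_countableAlgebra i.2.2)).continuous
  · refine eq_prod_of_map_vadd_fst_eq h1 h2 hp (map_vadd_fst_eq_of_additive ?_)
    intro A hA B hB b
    have : p ∈ translationGroup ρ := by
      rw [translationGroup, h]
      trivial
    exact this (⟨A, hA⟩, ⟨B, hB⟩) b

end Translation

/-! ### Generic points -/

section Generic

variable {X Y : Type*} [MeasurableSpace X] [MeasurableSpace Y] [AddAction ℝ X] [AddAction ℝ Y]
  {ρ : Measure (X × Y)} {s : ℝ}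

/-- The points along whose orbit under the time-`s` map the Birkhoff averages of all functions
`orbitTest A B b` converge to their integrals. -/
def flowGenericPoints [MeasurableSpace.CountablyGenerated X] [MeasurableSpace.CountablyGenerated Y]
    (ρ : Measure (X × Y)) (s : ℝ) : Set (X × Y) :=
  {w | ∀ A ∈ countableAlgebra X, ∀ B ∈ countableAlgebra Y, ∀ b,
    Tendsto (fun n => birkhoffAverage ℝ (fun w : X × Y => s +ᵥ w) (orbitTest A B b) n w) atTop
      (𝓝 (∫ w, orbitTest A B b w ∂ρ))}

theorem abs_birkhoffAverage_sub_le {Z : Type*} (T : Z → Z) {f g : Z → ℝ} {C : ℝ}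
    (h : ∀ z, |f z - g z| ≤ C) (n : ℕ) (z : Z) :
    |birkhoffAverage ℝ T f n z - birkhoffAverage ℝ T g n z| ≤ C := by
  have hC : 0 ≤ C := (abs_nonneg _).trans (h z)
  rcases Nat.eq_zero_or_pos n with rfl | hn
  · simpa using hC
  have hn' : (0 : ℝ) < n := by exact_mod_cast hn
  rw [birkhoffAverage, birkhoffAverage, ← smul_sub, birkhoffSum, birkhoffSum,
    ← Finset.sum_sub_distrib, smul_eq_mul, abs_mul, abs_inv, Nat.abs_cast, inv_mul_le_iff₀ hn']
  refine (Finset.abs_sum_le_sum_abs _ _).trans ((Finset.sum_le_sum fun k _ => h _).trans ?_)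
  simp

theorem ae_mem_flowGenericPoints [MeasurableSpace.CountablyGenerated X]
    [MeasurableSpace.CountablyGenerated Y] [MeasurableVAdd₂ ℝ X] [IsProbabilityMeasure ρ]
    (hs : Ergodic (fun w : X × Y => s +ᵥ w) ρ) : ∀ᵐ w ∂ρ, w ∈ flowGenericPoints ρ s := by
  have h1 : ∀ (A : countableAlgebra X) (B : countableAlgebra Y) (q : ℚ), ∀ᵐ w ∂ρ,
      Tendsto (fun n => birkhoffAverage ℝ (fun w : X × Y => s +ᵥ w) (orbitTest A.1 B.1 q) n w)
        atTop (𝓝 (∫ w, orbitTest A.1 B.1 q w ∂ρ)) := fun A B q =>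
    hs.ae_tendsto_birkhoffAverage (measurable_orbitTest (measurableSet_of_mem_countableAlgebra A.2)
      (measurableSet_of_mem_countableAlgebra B.2) q)
      (abs_orbitTest_le (measurableSet_of_mem_countableAlgebra A.2) q)
  filter_upwards [ae_all_iff.2 fun A => ae_all_iff.2 fun B => ae_all_iff.2 fun q => h1 A B q]
    with w hw A hA' B hB' b
  have hA := measurableSet_of_mem_countableAlgebra hA'
  have hB := measurableSet_of_mem_countableAlgebra hB'
  rw [Metric.tendsto_atTop]
  intro ε hε
  -- Replacing `b` by `q` moves every Birkhoff average, and the integral, by at most `|b - q|`.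
  obtain ⟨q, hq⟩ := exists_rat_near b (show 0 < ε / 3 by positivity)
  obtain ⟨N, hN⟩ := Metric.tendsto_atTop.1 (hw ⟨A, hA'⟩ ⟨B, hB'⟩ q) (ε / 3) (by positivity)
  refine ⟨N, fun n hn => ?_⟩
  have h2 := hN n hn
  have h3 := abs_birkhoffAverage_sub_le (fun w : X × Y => s +ᵥ w)
    (abs_orbitTest_sub_le (B := B) hA b q) n w
  have h4 := (lipschitzWith_integral_orbitTest (ρ := ρ) hA hB).dist_le_mul b q
  rw [Real.dist_eq] at h2 h4 ⊢
  rw [Real.dist_eq, NNReal.coe_one, one_mul] at h4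
  rw [abs_lt] at h2 ⊢
  rw [abs_le] at h3 h4
  constructor <;> linarith [h2.1, h2.2, h3.1, h3.2, h4.1, h4.2]

/-- Translation of the first coordinate commutes with the flow, so by `orbitTest_vadd` the averages
at the translated point are differences of averages at `(x, y)`. Comparing limits gives additivity
at `t`. -/
theorem mem_translationGroup_of_mem_flowGenericPoints [MeasurableSpace.CountablyGenerated X]
    [MeasurableSpace.CountablyGenerated Y] [MeasurableVAdd₂ ℝ X] {x : X} {y : Y} {t : ℝ}
    (h : (x, y) ∈ flowGenericPoints ρ s) (h' : (t +ᵥ x, y) ∈ flowGenericPoints ρ s) :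
    t ∈ translationGroup ρ := by
  rintro ⟨⟨A, hA'⟩, ⟨B, hB'⟩⟩ b
  have hA := measurableSet_of_mem_countableAlgebra hA'
  have h1 : ∀ n, birkhoffAverage ℝ (fun w : X × Y => s +ᵥ w) (orbitTest A B b) n (t +ᵥ x, y) =
      birkhoffAverage ℝ (fun w : X × Y => s +ᵥ w) (orbitTest A B (b + t)) n (x, y) -
        birkhoffAverage ℝ (fun w : X × Y => s +ᵥ w) (orbitTest A B t) n (x, y) := by
    intro n
    rw [birkhoffAverage, birkhoffAverage, birkhoffAverage, ← smul_sub, birkhoffSum, birkhoffSum,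
      birkhoffSum, ← Finset.sum_sub_distrib]
    congr 1
    refine Finset.sum_congr rfl fun k _ => ?_
    rw [vadd_iterate_apply, vadd_iterate_apply, Prod.vadd_mk, Prod.vadd_mk, vadd_comm,
      orbitTest_vadd hA]
  have h2 := h' A hA' B hB' b
  simp_rw [h1] at h2
  have h3 := tendsto_nhds_unique h2 ((h A hA' B hB' (b + t)).sub (h A hA' B hB' t))
  simp only
  linarith

end Generic

/-! ### The consequence of the Ratner property for a joining -/

section TestFunctions

variable {X Y : Type*} [MeasurableSpace X] [MeasurableSpace Y] {ρ : Measure (X × Y)} {B : Set Y}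

theorem integral_fst_mul_indicator_snd {f : X → ℝ} (hf : Measurable f) (hB : MeasurableSet B) :
    ∫ w, f w.1 * B.indicator 1 w.2 ∂ρ = ∫ x, f x ∂(ρ.restrict (Prod.snd ⁻¹' B)).map Prod.fst := by
  rw [integral_map measurable_fst.aemeasurable hf.aestronglyMeasurable,
    ← integral_indicator (measurable_snd hB)]
  refine integral_congr_ae (ae_of_all _ fun w => ?_)
  by_cases hw : w.2 ∈ B <;> simp [Set.indicator, hw]

variable [MetricSpace X] [BorelSpace X]

/-- Thickened indicators of a closed set are Lipschitz and converge to its indicator. Lipschitz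
functions are wanted because the Ratner property controls distances only up to a uniform `ε`. -/
theorem ext_of_lipschitz_prod {ρ₁ ρ₂ : Measure (X × Y)} [IsFiniteMeasure ρ₁] [IsFiniteMeasure ρ₂]
    (h : ∀ (f : X → ℝ) (K : NNReal) (B : Set Y), LipschitzWith K f → (∀ x, 0 ≤ f x) →
      (∀ x, f x ≤ 1) → MeasurableSet B →
      ∫ w, f w.1 * B.indicator 1 w.2 ∂ρ₁ = ∫ w, f w.1 * B.indicator 1 w.2 ∂ρ₂) : ρ₁ = ρ₂ := by
  have hslice : ∀ B : Set Y, MeasurableSet B →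
      (ρ₁.restrict (Prod.snd ⁻¹' B)).map Prod.fst =
        (ρ₂.restrict (Prod.snd ⁻¹' B)).map (Prod.fst : X × Y → X) := by
    intro B hB
    have hclosed : ∀ F : Set X, IsClosed F →
        (ρ₁.restrict (Prod.snd ⁻¹' B)).map Prod.fst F =
          (ρ₂.restrict (Prod.snd ⁻¹' B)).map Prod.fst F := by
      intro F hF
      have hpos : ∀ n : ℕ, (0 : ℝ) < 1 / ((n : ℝ) + 1) := fun n => Nat.one_div_pos_of_nat
      have h1 := tendsto_integral_thickenedIndicator_of_isClosed
        ((ρ₁.restrict (Prod.snd ⁻¹' B)).map Prod.fst) hF hpos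
        tendsto_one_div_add_atTop_nhds_zero_nat
      have h2 := tendsto_integral_thickenedIndicator_of_isClosed
        ((ρ₂.restrict (Prod.snd ⁻¹' B)).map Prod.fst) hF hpos
        tendsto_one_div_add_atTop_nhds_zero_nat
      have h3 : ∀ n, ∫ x, (thickenedIndicator (hpos n) F x : ℝ)
          ∂(ρ₁.restrict (Prod.snd ⁻¹' B)).map Prod.fst = ∫ x, (thickenedIndicator (hpos n) F x : ℝ)
          ∂(ρ₂.restrict (Prod.snd ⁻¹' B)).map Prod.fst := by
        intro n
        have hl := lipschitzWith_thickenedIndicator (hpos n) F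
        have hl' : LipschitzWith _ fun x => (thickenedIndicator (hpos n) F x : ℝ) :=
          fun x y => hl x y
        have := h _ _ B hl' (fun x => NNReal.coe_nonneg _)
          (fun x => by exact_mod_cast thickenedIndicator_le_one (hpos n) F x) hB
        rwa [integral_fst_mul_indicator_snd hl'.continuous.measurable hB,
          integral_fst_mul_indicator_snd hl'.continuous.measurable hB] at this
      have h4 := tendsto_nhds_unique h1 (h2.congr fun n => (h3 n).symm)
      exact (measureReal_eq_measureReal_iff).1 h4
    refine ext_of_generate_finite _ ?_ isPiSystem_isClosed hclosed (hclosed _ isClosed_univ)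
    rw [BorelSpace.measurable_eq (α := X), borel_eq_generateFrom_isClosed]
  have hrect : ∀ A : Set X, MeasurableSet A → ∀ B : Set Y, MeasurableSet B →
      ρ₁ (A ×ˢ B) = ρ₂ (A ×ˢ B) := by
    intro A hA B hB
    have := congrArg (fun τ => τ A) (hslice B hB)
    rwa [Measure.map_apply measurable_fst hA, Measure.restrict_apply (measurable_fst hA),
      Measure.map_apply measurable_fst hA, Measure.restrict_apply (measurable_fst hA),
      ← Set.prod_eq] at this
  refine ext_of_generate_finite _ generateFrom_prod.symm isPiSystem_prod ?_ ?_
  · rintro _ ⟨A, hA, B, hB, rfl⟩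
    exact hrect A hA B hB
  · rw [← univ_prod_univ]
    exact hrect _ MeasurableSet.univ _ MeasurableSet.univ

theorem exists_test_of_map_vadd_fst_ne [AddAction ℝ X] [MeasurableVAdd₂ ℝ X] [IsFiniteMeasure ρ]
    {p : ℝ} (h : ρ.map (fun w => (p +ᵥ w.1, w.2)) ≠ ρ) :
    ∃ (f : X → ℝ) (K : NNReal) (B : Set Y), LipschitzWith K f ∧ (∀ x, 0 ≤ f x) ∧
      (∀ x, f x ≤ 1) ∧ MeasurableSet B ∧
      ∫ w, f w.1 * B.indicator 1 w.2 ∂ρ ≠ ∫ w, f (p +ᵥ w.1) * B.indicator 1 w.2 ∂ρ := by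
  by_contra! hcon
  have hmeas : Measurable fun w : X × Y => (p +ᵥ w.1, w.2) :=
    ((measurable_const_vadd p).comp measurable_fst).prodMk measurable_snd
  refine h (ext_of_lipschitz_prod fun f K B hf h0 h1 hB => ?_)
  rw [hcon f K B hf h0 h1 hB, integral_map hmeas.aemeasurable]
  exact ((hf.continuous.measurable.comp measurable_fst).mul
    ((measurable_one.indicator hB).comp measurable_snd)).aestronglyMeasurable

end TestFunctions

/-! ### Birkhoff sums over windows -/

section Windows

variable {Z : Type*} {T : Z → Z}

/-- A window sum is the difference of the sums up to `M + L` and up to `M`, and the errors add. The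
bound is useful only when `M` is at most a fixed multiple of `L`, which the condition `L / M ≥ κ`
ensures. -/
theorem abs_sum_window_sub_le {f : Z → ℝ} {I η : ℝ} {N : ℕ} {z : Z}
    (h : ∀ n, N ≤ n → |birkhoffAverage ℝ T f n z - I| ≤ η) {M : ℕ} (hM : N ≤ M) (L : ℕ) :
    |∑ k ∈ Finset.range L, f (T^[M + k] z) - L * I| ≤ η * (2 * M + L) := by
  have h1 : ∀ n, N ≤ n → |birkhoffSum T f n z - n * I| ≤ η * n := by
    intro n hn
    rcases Nat.eq_zero_or_pos n with rfl | hn0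
    · simp
    have hn' : (0 : ℝ) < n := by exact_mod_cast hn0
    have h2 := h n hn
    have h3 : birkhoffSum T f n z - n * I = n * (birkhoffAverage ℝ T f n z - I) := by
      rw [birkhoffAverage, smul_eq_mul, mul_sub, mul_inv_cancel_left₀ hn'.ne']
    rw [h3, abs_mul, Nat.abs_cast, mul_comm]
    exact mul_le_mul_of_nonneg_right h2 hn'.le
  have h2 : ∑ k ∈ Finset.range L, f (T^[M + k] z) =
      birkhoffSum T f (M + L) z - birkhoffSum T f M z := by
    rw [birkhoffSum, birkhoffSum, Finset.sum_range_add, add_sub_cancel_left]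
  have h3 := abs_le.1 (h1 M hM)
  have h4 := abs_le.1 (h1 (M + L) (hM.trans (Nat.le_add_right M L)))
  push_cast at h4
  rw [h2, abs_le]
  constructor <;> linarith [h3.1, h3.2, h4.1, h4.2]

variable [MeasurableSpace Z] {ρ : Measure Z}

theorem measurable_birkhoffAverage (hT : Measurable T) {f : Z → ℝ} (hf : Measurable f) (n : ℕ) :
    Measurable (birkhoffAverage ℝ T f n) := by
  have : Measurable (birkhoffSum T f n) :=
    Finset.measurable_fun_sum _ fun k _ => hf.comp (hT.iterate k)
  exact this.const_smul ((n : ℝ)⁻¹)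

theorem exists_uniform_birkhoffAverage [IsProbabilityMeasure ρ] (hT : Ergodic T ρ) {ι : Type*}
    [Finite ι] {f : ι → Z → ℝ} (hf : ∀ i, Measurable (f i)) {C : ℝ} (hC : ∀ i z, |f i z| ≤ C)
    {η ε : ℝ} (hη : 0 < η) (hε : 0 < ε) :
    ∃ (N : ℕ) (U : Set Z), MeasurableSet U ∧ 1 - ε < ρ.real U ∧
      ∀ z ∈ U, ∀ i n, N ≤ n → |birkhoffAverage ℝ T (f i) n z - ∫ z, f i z ∂ρ| ≤ η := by
  set U : ℕ → Set Z := fun N =>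
    {z | ∀ i n, N ≤ n → |birkhoffAverage ℝ T (f i) n z - ∫ z, f i z ∂ρ| ≤ η} with hU
  have hmeas : ∀ N, MeasurableSet (U N) := by
    intro N
    simp only [hU, ofPred_forall]
    refine MeasurableSet.iInter fun i => MeasurableSet.iInter fun n => MeasurableSet.iInter fun _ =>
      measurableSet_le ?_ measurable_const
    exact ((measurable_birkhoffAverage hT.measurable (hf i) n).sub measurable_const).abs
  have hmono : Monotone U := fun N N' hN z hz i n hn => hz i n (hN.trans hn)
  have hfull : ρ (⋃ N, U N) = 1 := by
    rw [prob_compl_eq_zero_iff (MeasurableSet.iUnion hmeas) |>.symm, ← mem_ae_iff]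
    filter_upwards [ae_all_iff.2 fun i => hT.ae_tendsto_birkhoffAverage (hf i) (hC i)] with z hz
    have h1 : ∀ i, ∀ᶠ n in atTop, |birkhoffAverage ℝ T (f i) n z - ∫ z, f i z ∂ρ| ≤ η := fun i =>
      (Metric.tendsto_nhds.1 (hz i) η hη).mono fun n hn => (Real.dist_eq _ _ ▸ hn).le
    obtain ⟨N, hN⟩ := eventually_atTop.1 (eventually_all.2 h1)
    exact mem_iUnion.2 ⟨N, fun i n hn => hN n hn i⟩
  have hlim := tendsto_measure_iUnion_atTop (μ := ρ) hmono
  rw [hfull] at hlim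
  have hlim' := (ENNReal.tendsto_toReal ENNReal.one_ne_top).comp hlim
  obtain ⟨N, hN⟩ := (hlim'.eventually_const_lt
    (show 1 - ε < (1 : ℝ≥0∞).toReal by rw [ENNReal.toReal_one]; linarith)).exists
  exact ⟨N, U N, hmeas N, hN, fun z hz => hz⟩

end Windows

/-! ### Separation of orbits in the fibres of a joining -/

section Ratner

variable {X Y : Type*} [MetricSpace X] [MeasurableSpace X] [BorelSpace X] [MeasurableSpace Y]
  [AddAction ℝ X] [MeasurableVAdd₂ ℝ X] [AddAction ℝ Y] {μ : Measure X} {ρ : Measure (X × Y)}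

/-- The sums of two sequences with values in `[0, 1]` are close if the sequences differ by at most
`η` at no fewer than `(1 - ε) L` of the indices `k ≤ L`. -/
theorem abs_sum_sub_sum_le_of_card {a b : ℕ → ℝ} (ha : ∀ k, 0 ≤ a k ∧ a k ≤ 1)
    (hb : ∀ k, 0 ≤ b k ∧ b k ≤ 1) {η ε : ℝ} (hη : 0 ≤ η) {L : ℕ} {C : Finset ℕ}
    (hCL : C ⊆ Finset.range (L + 1)) (hC : ∀ k ∈ C, |a k - b k| ≤ η)
    (hcard : (1 - ε) * L ≤ C.card) :
    |∑ k ∈ Finset.range (L + 1), a k - ∑ k ∈ Finset.range (L + 1), b k| ≤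
      η * (L + 1) + (1 + ε * L) := by
  rw [← Finset.sum_sub_distrib]
  refine (Finset.abs_sum_le_sum_abs _ _).trans ?_
  rw [← Finset.sum_sdiff hCL]
  have h1 : ∑ k ∈ C, |a k - b k| ≤ C.card * η := by
    rw [← nsmul_eq_mul]
    exact Finset.sum_le_card_nsmul _ _ _ hC
  -- The closed window has `L + 1` points but the density is relative to `L`, so up to `1 + ε L`
  -- indices lie outside `C`, each contributing at most `1`.
  have h2 : ∑ k ∈ Finset.range (L + 1) \ C, |a k - b k| ≤ (Finset.range (L + 1) \ C).card := by
    rw [← mul_one ((Finset.range (L + 1) \ C).card : ℝ), ← nsmul_eq_mul]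
    refine Finset.sum_le_card_nsmul _ _ _ fun k _ => ?_
    rw [abs_le]
    constructor <;> linarith [(ha k).1, (ha k).2, (hb k).1, (hb k).2]
  have h3 : ((Finset.range (L + 1) \ C).card : ℝ) = L + 1 - C.card := by
    rw [Finset.card_sdiff_of_subset hCL, Nat.cast_sub (Finset.card_le_card hCL), Finset.card_range]
    push_cast
    ring
  have h4 : (C.card : ℝ) ≤ L + 1 := by
    have := Finset.card_le_card hCL
    rw [Finset.card_range] at this
    exact_mod_cast this
  have := mul_le_mul_of_nonneg_right h4 hη
  linarith

theorem ncard_window_le (M L : ℕ) (Q : ℤ → Prop) [DecidablePred fun k : ℕ => Q (M + k : ℕ)] :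
    Set.ncard {n : ℤ | n ∈ Set.Icc (M : ℤ) (M + L) ∧ Q n} ≤
      ((Finset.range (L + 1)).filter fun k => Q (M + k : ℕ)).card := by
  classical
  rw [← Set.ncard_coe_finset]
  refine Set.ncard_le_ncard_of_injOn (fun n : ℤ => (n - M).toNat) ?_ ?_ (Finset.finite_toSet _)
  · rintro n ⟨⟨h1, h2⟩, h3⟩
    simp only [Finset.coe_filter, Finset.mem_range]
    refine ⟨by omega, ?_⟩
    have : ((M + (n - M).toNat : ℕ) : ℤ) = n := by omega
    rwa [this]
  · rintro n ⟨⟨h1, h2⟩, -⟩ m ⟨⟨h3, h4⟩, -⟩ h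
    simp only at h
    omega

/-- If no translation of the first coordinate by an element of `P` preserves `ρ`, then the Ratner
property provides a set of positive measure on whose fibres nearby points are in the same orbit. -/
theorem RatnerPropertyAt.exists_fibre_separated [IsProbabilityMeasure ρ] {t₀ : ℝ} {P : Finset ℝ}
    (hR : RatnerPropertyAt μ t₀ P) (hfst : ρ.map Prod.fst = μ)
    (herg : Ergodic (fun w : X × Y => t₀ +ᵥ w) ρ)
    (hP : ∀ p ∈ P, ρ.map (fun w => (p +ᵥ w.1, w.2)) ≠ ρ) :
    ∃ δ : ℝ, 0 < δ ∧ ∃ W : Set (X × Y), MeasurableSet W ∧ ρ W ≠ 0 ∧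
      ∀ x x' y, (x, y) ∈ W → (x', y) ∈ W → dist x x' < δ → x' ∈ AddAction.orbit ℝ x := by
  classical
  choose f K B hlip hf0 hf1 hB hne using fun p : P => exists_test_of_map_vadd_fst_ne (hP p p.2)
  set F : P → X × Y → ℝ := fun p w => f p w.1 * (B p).indicator 1 w.2 with hF
  set G : P → X × Y → ℝ := fun p w => f p ((p : ℝ) +ᵥ w.1) * (B p).indicator 1 w.2 with hG
  have hFm : ∀ p, Measurable (F p) := fun p =>
    ((hlip p).continuous.measurable.comp measurable_fst).mul
      ((measurable_one.indicator (hB p)).comp measurable_snd)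
  have hGm : ∀ p, Measurable (G p) := fun p =>
    ((hlip p).continuous.measurable.comp ((measurable_const_vadd (p : ℝ)).comp measurable_fst)).mul
      ((measurable_one.indicator (hB p)).comp measurable_snd)
  have hF01 : ∀ p w, 0 ≤ F p w ∧ F p w ≤ 1 := fun p w => by
    by_cases hw : w.2 ∈ B p <;> simp [hF, hw, hf0, hf1]
  have hG01 : ∀ p w, 0 ≤ G p w ∧ G p w ≤ 1 := fun p w => by
    by_cases hw : w.2 ∈ B p <;> simp [hG, hw, hf0, hf1]
  -- The errors below add up to at most `5 * η * (L + 1)`; the factor `8` leaves room.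
  have hη : ∃ η : ℝ, 0 < η ∧ ∀ p, 8 * η ≤ |∫ w, F p w ∂ρ - ∫ w, G p w ∂ρ| := by
    have h1 : ∀ᶠ η : ℝ in 𝓝[>] 0, ∀ p, 8 * η ≤ |∫ w, F p w ∂ρ - ∫ w, G p w ∂ρ| := by
      refine eventually_all.2 fun p => ?_
      have h2 : Tendsto (fun η : ℝ => 8 * η) (𝓝[>] 0) (𝓝 0) := by
        have : Tendsto (fun η : ℝ => 8 * η) (𝓝 0) (𝓝 (8 * 0)) := tendsto_id.const_mul 8
        rw [mul_zero] at this
        exact this.mono_left nhdsWithin_le_nhds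
      exact h2.eventually_le_const (abs_pos.2 (sub_ne_zero.2 (hne p)))
    obtain ⟨η, h2, h3⟩ := (h1.and self_mem_nhdsWithin).exists
    exact ⟨η, h3, h2⟩
  obtain ⟨η, hη0, hη⟩ := hη
  -- The three bounds control the bad indices, make two sets of measure above `1 - ε` meet in
  -- positive measure, and bound the change of `f p` over a distance `ε`.
  have hε : ∃ ε : ℝ, 0 < ε ∧ ε ≤ η ∧ ε ≤ 1 / 2 ∧ ∀ p, K p * ε ≤ η := by
    have h1 : ∀ᶠ ε : ℝ in 𝓝[>] 0, ∀ p, K p * ε ≤ η := by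
      refine eventually_all.2 fun p => ?_
      have h2 : Tendsto (fun ε : ℝ => K p * ε) (𝓝[>] 0) (𝓝 0) := by
        have : Tendsto (fun ε : ℝ => K p * ε) (𝓝 0) (𝓝 (K p * 0)) := tendsto_id.const_mul _
        rw [mul_zero] at this
        exact this.mono_left nhdsWithin_le_nhds
      exact h2.eventually_le_const hη0
    have h2 : ∀ᶠ ε : ℝ in 𝓝[>] 0, ε ≤ η ∧ ε ≤ 1 / 2 :=
      ((eventually_le_nhds hη0).and (eventually_le_nhds (half_pos one_pos))).filter_mono
        nhdsWithin_le_nhds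
    obtain ⟨ε, ⟨h2, h4, h5⟩, h3⟩ := ((h1.and h2).and self_mem_nhdsWithin).exists
    exact ⟨ε, h3, h4, h5, h2⟩
  obtain ⟨ε, hε0, hεη, hε1, hKε⟩ := hε
  obtain ⟨κ, hκ, hN⟩ := hR.2 ε hε0
  -- Since `M ≤ L / κ`, this makes the window error at most `η * (L + 1)`. The choice is possible
  -- because `κ` is fixed before `N`.
  set η' : ℝ := η / (2 / κ + 1) with hη'
  have hη'0 : 0 < η' := by positivity
  obtain ⟨N₀, U, hU, hUρ, hUN⟩ := exists_uniform_birkhoffAverage herg (f := Sum.elim F G)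
    (fun i => by rcases i with p | p; exacts [hFm p, hGm p]) (C := 1)
    (fun i w => by
      rcases i with p | p
      · exact abs_le.2 ⟨by simp; linarith [(hF01 p w).1], (hF01 p w).2⟩
      · exact abs_le.2 ⟨by simp; linarith [(hG01 p w).1], (hG01 p w).2⟩) hη'0 hε0
  -- With `L ≥ N₁` the one surplus index of the closed window costs at most `η * (L + 1)`.
  obtain ⟨N₁, hN₁⟩ := exists_nat_ge (1 / η)
  obtain ⟨δ, hδ, Z, hZ, hZμ, hsep⟩ := hN (max (max N₀ N₁) 1)
  refine ⟨δ, hδ, U ∩ Prod.fst ⁻¹' Z, hU.inter (measurable_fst hZ), ?_, ?_⟩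
  · intro h0
    have h1 : ρ.real (Prod.fst ⁻¹' Z) = μ.real Z := by
      rw [← hfst, map_measureReal_apply measurable_fst hZ]
    have h2 := measureReal_union_add_inter (μ := ρ) (s := U) (t := Prod.fst ⁻¹' Z)
      (measurable_fst hZ)
    rw [measureReal_def ρ (U ∩ _), h0, h1, ENNReal.toReal_zero, add_zero] at h2
    have h3 : ρ.real (U ∪ Prod.fst ⁻¹' Z) ≤ 1 := measureReal_le_one
    linarith
  rintro x x' y ⟨hxU, hxZ⟩ ⟨hxU', hxZ'⟩ hd
  by_contra horb
  obtain ⟨M, L, hM, hL, hκL, p, hp, hcount⟩ := hsep x hxZ x' hxZ' horb hd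
  have hM0 : N₀ ≤ M := (le_max_left _ _).trans ((le_max_left _ _).trans hM)
  have hL1 : N₁ ≤ L := (le_max_right _ _).trans ((le_max_left _ _).trans hL)
  have hMpos : (0 : ℝ) < M := by exact_mod_cast (le_max_right _ _).trans hM
  have hLpos : (0 : ℝ) < L := by exact_mod_cast (le_max_right _ _).trans hL
  have hiter : ∀ (n : ℕ) (v : X), (fun w : X × Y => t₀ +ᵥ w)^[n] (v, y) =
      ((n * t₀ : ℝ) +ᵥ v, (n * t₀ : ℝ) +ᵥ y) := fun n v => by
    rw [vadd_iterate_apply, nsmul_eq_mul, Prod.vadd_mk]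
  set C := (Finset.range (L + 1)).filter fun k =>
    dist ((((M + k : ℕ) : ℤ) * t₀ : ℝ) +ᵥ x) ((((M + k : ℕ) : ℤ) * t₀ + p : ℝ) +ᵥ x') < ε with hC
  have hcard : (1 - ε) * L ≤ C.card := by
    rw [lt_div_iff₀ hLpos] at hcount
    refine hcount.le.trans ?_
    exact_mod_cast ncard_window_le M L fun n : ℤ =>
      dist ((n * t₀ : ℝ) +ᵥ x) ((n * t₀ + p : ℝ) +ᵥ x') < ε
  -- The points share the coordinate `y`, so the indicator factor is common. The shift by `p` inside
  -- `G` is the one in the Ratner property.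
  have hclose : ∀ k ∈ C, |F ⟨p, hp⟩ ((fun w : X × Y => t₀ +ᵥ w)^[M + k] (x, y)) -
      G ⟨p, hp⟩ ((fun w : X × Y => t₀ +ᵥ w)^[M + k] (x', y))| ≤ η := by
    intro k hk
    have hk' := (Finset.mem_filter.1 hk).2
    rw [Int.cast_natCast] at hk'
    rw [hiter, hiter]
    simp only [hF, hG]
    rw [← sub_mul, abs_mul, ← add_vadd, add_comm p]
    have h1 := (hlip ⟨p, hp⟩).dist_le_mul ((((M + k : ℕ) : ℝ) * t₀ : ℝ) +ᵥ x)
      ((((M + k : ℕ) : ℝ) * t₀ + p : ℝ) +ᵥ x')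
    rw [Real.dist_eq] at h1
    have h2 := mul_le_mul_of_nonneg_left hk'.le (K ⟨p, hp⟩).coe_nonneg
    have h3 := (h1.trans h2).trans (hKε ⟨p, hp⟩)
    exact (mul_le_mul h3 (abs_indicator_one_le _ _) (abs_nonneg _) hη0.le).trans_eq (mul_one η)
  have key := abs_sum_sub_sum_le_of_card
    (a := fun k => F ⟨p, hp⟩ ((fun w : X × Y => t₀ +ᵥ w)^[M + k] (x, y)))
    (b := fun k => G ⟨p, hp⟩ ((fun w : X × Y => t₀ +ᵥ w)^[M + k] (x', y)))
    (fun k => hF01 _ _) (fun k => hG01 _ _) hη0.le (Finset.filter_subset _ _) hclose hcard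
  have hwF := abs_sum_window_sub_le (T := fun w : X × Y => t₀ +ᵥ w) (f := F ⟨p, hp⟩)
    (hUN (x, y) hxU (Sum.inl ⟨p, hp⟩)) hM0 (L + 1)
  have hwG := abs_sum_window_sub_le (T := fun w : X × Y => t₀ +ᵥ w) (f := G ⟨p, hp⟩)
    (hUN (x', y) hxU' (Sum.inr ⟨p, hp⟩)) hM0 (L + 1)
  simp only [Sum.elim_inl, Sum.elim_inr] at hwF hwG
  set SF := ∑ k ∈ Finset.range (L + 1), F ⟨p, hp⟩ ((fun w : X × Y => t₀ +ᵥ w)^[M + k] (x, y))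
  set SG := ∑ k ∈ Finset.range (L + 1), G ⟨p, hp⟩ ((fun w : X × Y => t₀ +ᵥ w)^[M + k] (x', y))
  set IF := ∫ w, F ⟨p, hp⟩ w ∂ρ
  set IG := ∫ w, G ⟨p, hp⟩ w ∂ρ
  have hbound : η' * (2 * M + (L + 1 : ℕ)) ≤ η * (L + 1) := by
    have h1 : (M : ℝ) ≤ L / κ := by
      rw [le_div_iff₀ hκ, mul_comm]
      exact (le_div_iff₀ hMpos).1 hκL
    have h2 : 2 * (M : ℝ) + (L + 1 : ℕ) ≤ (2 / κ + 1) * (L + 1) := by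
      have h3 : (2 / κ + 1) * ((L : ℝ) + 1) = 2 * (L / κ) + 2 / κ + (L + 1) := by ring
      have h4 : 0 ≤ 2 / κ := by positivity
      push_cast
      linarith
    calc η' * (2 * M + (L + 1 : ℕ)) ≤ η' * ((2 / κ + 1) * (L + 1)) :=
          mul_le_mul_of_nonneg_left h2 hη'0.le
      _ = η * (L + 1) := by
          rw [hη', ← mul_assoc, div_mul_cancel₀]
          positivity
  have hone : 1 ≤ η * (L + 1) := by
    have h1 : 1 / η ≤ L := hN₁.trans (by exact_mod_cast hL1)
    rw [div_le_iff₀ hη0] at h1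
    linarith
  have hεL : ε * L ≤ η * (L + 1) := by
    have := mul_le_mul_of_nonneg_right hεη hLpos.le
    linarith
  have hgap : 8 * (η * (L + 1)) ≤ |(L + 1 : ℕ) * IF - (L + 1 : ℕ) * IG| := by
    rw [← mul_sub, abs_mul, Nat.abs_cast]
    have := mul_le_mul_of_nonneg_left (hη ⟨p, hp⟩) (by positivity : (0 : ℝ) ≤ L + 1)
    push_cast
    linarith
  have htri : |(L + 1 : ℕ) * IF - (L + 1 : ℕ) * IG| ≤
      |SF - (L + 1 : ℕ) * IF| + |SF - SG| + |SG - (L + 1 : ℕ) * IG| := by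
    have h1 := abs_sub_le ((L + 1 : ℕ) * IF) SF ((L + 1 : ℕ) * IG)
    have h2 := abs_sub_le SF SG ((L + 1 : ℕ) * IG)
    rw [abs_sub_comm _ SF] at h1
    linarith
  have hpos : 0 < η * (L + 1) := by positivity
  linarith

end Ratner

/-! ### A σ-compact metric space is standard Borel -/

theorem MeasurableEquiv.standardBorelSpace {α β : Type*} [MeasurableSpace α] [MeasurableSpace β]
    [StandardBorelSpace β] (e : α ≃ᵐ β) : StandardBorelSpace α := by
  let := upgradeStandardBorel β
  let : TopologicalSpace α := TopologicalSpace.induced e inferInstance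
  have hpol : PolishSpace α := e.toEquiv.polishSpace_induced
  refine ⟨⟨inferInstance, ⟨?_⟩, hpol⟩⟩
  have h1 : ‹MeasurableSpace α› = MeasurableSpace.comap e inferInstance :=
    e.measurableEmbedding.comap_eq.symm
  exact h1.trans ((congrArg (MeasurableSpace.comap (e : α → β))
    (eq_borel_upgradeStandardBorel β)).trans borel_comap.symm)

/-- A σ-compact space is a countable union of closed sets in its completion, which is Polish. This
provides the disintegration although `X` need not be complete. -/
theorem standardBorelSpace_of_sigmaCompactSpace {X : Type*} [MetricSpace X] [SigmaCompactSpace X]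
    [MeasurableSpace X] [BorelSpace X] : StandardBorelSpace X := by
  borelize (UniformSpace.Completion X)
  have hemb : IsEmbedding ((↑) : X → UniformSpace.Completion X) :=
    UniformSpace.Completion.coe_isometry.isEmbedding
  have hcont := hemb.continuous
  have hrange : MeasurableSet (range ((↑) : X → UniformSpace.Completion X)) := by
    rw [← image_univ, ← iUnion_compactCovering X, image_iUnion]
    exact MeasurableSet.iUnion fun n =>
      ((isCompact_compactCovering X n).image hcont).isClosed.measurableSet
  have : SecondCountableTopology X := inferInstance
  have : TopologicalSpace.SeparableSpace (UniformSpace.Completion X) :=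
    UniformSpace.Completion.separableSpace_completion
  have : SecondCountableTopology (UniformSpace.Completion X) :=
    UniformSpace.secondCountable_of_separable _
  have : PolishSpace (UniformSpace.Completion X) := inferInstance
  have := hrange.standardBorel
  exact hemb.toHomeomorph.toMeasurableEquiv.standardBorelSpace

/-! ### Disintegration over the second coordinate -/

section Atoms

variable {X Y : Type*} [MeasurableSpace X] [MeasurableSpace Y]

/-- A probability measure almost all of whose points are atoms of the same mass is the uniform
measure on a finite set. -/
theorem exists_finset_eq_sum_dirac [MeasurableSingletonClass X] {τ : Measure X}
    [IsProbabilityMeasure τ] {c : ℝ≥0∞} (hc : c ≠ 0) (h : ∀ᵐ x ∂τ, τ {x} = c) :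
    ∃ F : Finset X, F.card * c = 1 ∧ τ = c • ∑ x ∈ F, Measure.dirac x := by
  classical
  have hcard : ∀ F : Finset X, (∀ x ∈ F, τ {x} = c) → τ F = F.card * c := fun F hF => by
    rw [← sum_measure_singleton, Finset.sum_congr rfl hF, Finset.sum_const, nsmul_eq_mul]
  have hfin : {x | τ {x} = c}.Finite := by
    by_contra hinf
    obtain ⟨n, hn⟩ := ENNReal.exists_nat_mul_gt hc ENNReal.one_ne_top
    obtain ⟨F, hFs, rfl⟩ := Set.Infinite.exists_subset_card_eq hinf n
    rw [← hcard F fun x hx => hFs hx] at hn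
    exact hn.not_ge prob_le_one
  have hmem : ∀ x ∈ hfin.toFinset, τ {x} = c := fun x hx => (hfin.mem_toFinset).1 hx
  have hfull : ∀ᵐ x ∂τ, x ∈ hfin.toFinset := by
    filter_upwards [h] with x hx
    exact (hfin.mem_toFinset).2 hx
  refine ⟨hfin.toFinset, ?_, ?_⟩
  · rw [← hcard _ hmem]
    exact (prob_compl_eq_zero_iff hfin.toFinset.measurableSet).1 hfull
  · ext E hE
    have h1 : τ E = τ ((hfin.toFinset.filter (· ∈ E) : Finset X) : Set X) := by
      refine measure_congr ?_
      filter_upwards [hfull] with x hx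
      refine propext ⟨fun hxE => ?_, fun hxE => ?_⟩
      · exact Finset.mem_coe.2 (Finset.mem_filter.2 ⟨hx, hxE⟩)
      · exact (Finset.mem_filter.1 (Finset.mem_coe.1 hxE)).2
    rw [h1, hcard _ fun x hx => hmem x (Finset.mem_filter.1 hx).1, Measure.smul_apply,
      Measure.finsetSum_apply, smul_eq_mul, mul_comm]
    simp only [Measure.dirac_apply' _ hE, Set.indicator_apply, Pi.one_apply, Finset.sum_boole]

variable {ν : Measure Y} {ρ : Measure (X × Y)}

theorem fst_map_swap_eq (h2 : ρ.map Prod.snd = ν) : (ρ.map Prod.swap).fst = ν := by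
  rw [Measure.fst_map_swap, Measure.snd, h2]

variable [StandardBorelSpace X] [Nonempty X] [IsProbabilityMeasure ρ]

/-- The fibre measures of `ρ` over the second coordinate. -/
noncomputable def fibreKernel (ρ : Measure (X × Y)) [IsFiniteMeasure ρ] : Kernel Y X :=
  (ρ.map Prod.swap).condKernel

instance : IsMarkovKernel (fibreKernel ρ) :=
  inferInstanceAs (IsMarkovKernel (ρ.map Prod.swap).condKernel)

theorem compProd_fibreKernel (h2 : ρ.map Prod.snd = ν) :
    ν ⊗ₘ fibreKernel ρ = ρ.map Prod.swap := by
  rw [← fst_map_swap_eq h2]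
  exact Measure.disintegrate (ρ.map Prod.swap) (ρ.map Prod.swap).condKernel

theorem measure_eq_lintegral_fibreKernel (h2 : ρ.map Prod.snd = ν) {E : Set (X × Y)}
    (hE : MeasurableSet E) : ρ E = ∫⁻ y, fibreKernel ρ y {x | (x, y) ∈ E} ∂ν := by
  have : IsProbabilityMeasure ν :=
    h2 ▸ Measure.isProbabilityMeasure_map measurable_snd.aemeasurable
  have h := Measure.compProd_apply (μ := ν) (κ := fibreKernel ρ) (measurable_swap hE)
  rw [compProd_fibreKernel h2, Measure.map_apply measurable_swap (measurable_swap hE)] at h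
  exact h

theorem ae_ae_fibreKernel (h2 : ρ.map Prod.snd = ν) {Q : X × Y → Prop} (h : ∀ᵐ w ∂ρ, Q w) :
    ∀ᵐ y ∂ν, ∀ᵐ x ∂fibreKernel ρ y, Q (x, y) := by
  have : IsProbabilityMeasure ν :=
    h2 ▸ Measure.isProbabilityMeasure_map measurable_snd.aemeasurable
  refine Measure.ae_ae_of_ae_compProd (p := fun w : Y × X => Q w.swap) ?_
  rw [compProd_fibreKernel h2]
  exact (MeasurableEquiv.prodComm.measurableEmbedding.ae_map_iff).2 h

/-- The mass of the point `x` in the fibre measure over `y`. -/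
noncomputable def fibreMass (ρ : Measure (X × Y)) [IsFiniteMeasure ρ] (w : X × Y) : ℝ≥0∞ :=
  fibreKernel ρ w.2 {w.1}

theorem measurable_fibreMass : Measurable (fibreMass ρ) := by
  have h : MeasurableSet {p : (X × Y) × X | p.2 = p.1.1} :=
    measurableSet_eq_fun measurable_snd (measurable_fst.comp measurable_fst)
  have := Kernel.measurable_kernel_prodMk_left
    (κ := (fibreKernel ρ).comap Prod.snd (measurable_snd (α := X))) h
  exact this

/-- Almost every fibre measure is uniform on a set `F` with `F.card * c = 1`, so the cardinality
does not depend on `y`. -/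
theorem isFiniteExtension_of_fibreMass_ae_eq (h2 : ρ.map Prod.snd = ν) {c : ℝ≥0∞} (hc : c ≠ 0)
    (h : ∀ᵐ w ∂ρ, fibreMass ρ w = c) : IsFiniteExtension (Prod.snd : X × Y → Y) ρ ν := by
  classical
  have hν : IsProbabilityMeasure ν :=
    h2 ▸ Measure.isProbabilityMeasure_map measurable_snd.aemeasurable
  have h1 : ∀ᵐ y ∂ν, ∃ F : Finset X, F.card * c = 1 ∧
      fibreKernel ρ y = c • ∑ x ∈ F, Measure.dirac x := by
    filter_upwards [ae_ae_fibreKernel h2 h] with y hy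
    exact exists_finset_eq_sum_dirac hc hy
  obtain ⟨-, F₀, hF₀, -⟩ := h1.exists
  have hcF : c = (F₀.card : ℝ≥0∞)⁻¹ := ENNReal.eq_inv_of_mul_eq_one_left ((mul_comm _ _).trans hF₀)
  refine ⟨F₀.card, Nat.one_le_iff_ne_zero.2 fun h0 => by simp [h0] at hF₀,
    fibreKernel ρ ×ₖ Kernel.id, ?_, ?_⟩
  · ext E hE
    rw [Measure.bind_apply hE (Kernel.aemeasurable _), measure_eq_lintegral_fibreKernel h2 hE]
    refine lintegral_congr fun y => ?_
    rw [Kernel.prod_apply, Kernel.id_apply, Measure.prod_dirac,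
      Measure.map_apply measurable_prodMk_right hE]
    rfl
  · filter_upwards [h1] with y hy
    obtain ⟨F, hF, hFy⟩ := hy
    refine ⟨F.map ⟨fun x => (x, y), fun _ _ h => (Prod.mk.inj h).1⟩, ?_, ?_, ?_⟩
    · rw [Finset.card_map]
      have h3 : c = (F.card : ℝ≥0∞)⁻¹ := ENNReal.eq_inv_of_mul_eq_one_left ((mul_comm _ _).trans hF)
      rw [hcF, inv_inj] at h3
      exact_mod_cast h3.symm
    · intro w hw
      obtain ⟨x, -, rfl⟩ := Finset.mem_map.1 hw
      rfl
    · rw [Kernel.prod_apply, Kernel.id_apply, Measure.prod_dirac, hFy, Measure.map_smul,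
        Measure.map_finset_sum measurable_prodMk_right.aemeasurable, ← hcF, Finset.sum_map]
      simp only [Measure.map_dirac' measurable_prodMk_right]
      rfl

/-- The fibre measures of an invariant measure are equivariant. -/
theorem fibreKernel_vadd_ae_eq [AddAction ℝ X] [AddAction ℝ Y] [MeasurableVAdd₂ ℝ X]
    [MeasurableVAdd₂ ℝ Y] [VAddInvariantMeasure ℝ Y ν] [VAddInvariantMeasure ℝ (X × Y) ρ]
    (h2 : ρ.map Prod.snd = ν) (s : ℝ) :
    ∀ᵐ y ∂ν, ∀ x, fibreKernel ρ (s +ᵥ y) {s +ᵥ x} = fibreKernel ρ y {x} := by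
  have hν : IsProbabilityMeasure ν :=
    h2 ▸ Measure.isProbabilityMeasure_map measurable_snd.aemeasurable
  -- The fibre measure over `s +ᵥ y`, moved back by `-s`. By invariance these also disintegrate `ρ`,
  -- so uniqueness identifies the two kernels almost everywhere.
  set κ : Kernel Y X := ((fibreKernel ρ).comap (fun y : Y => s +ᵥ y)
    (measurable_const_vadd s)).map (fun x : X => -s +ᵥ x) with hκ
  have hm : Measurable fun x : X => -s +ᵥ x := measurable_const_vadd _
  have : IsMarkovKernel κ := Kernel.IsMarkovKernel.map _ hm
  have hκy : ∀ y E, MeasurableSet E → κ y E = fibreKernel ρ (s +ᵥ y) {x | -s +ᵥ x ∈ E} := by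
    intro y E hE
    rw [hκ, Kernel.map_apply' _ hm _ hE, Kernel.comap_apply]
    rfl
  have hdis : ρ.map Prod.swap = (ρ.map Prod.swap).fst ⊗ₘ κ := by
    rw [fst_map_swap_eq h2]
    ext E hE
    have hE' : MeasurableSet {w : X × Y | ((-s +ᵥ w.2 : Y), (-s +ᵥ w.1 : X)) ∈ E} :=
      (((measurable_const_vadd (-s)).comp measurable_snd).prodMk
        ((measurable_const_vadd (-s)).comp measurable_fst)) hE
    have hinv : ρ (Prod.swap ⁻¹' E) = ρ {w : X × Y | ((-s +ᵥ w.2 : Y), (-s +ᵥ w.1 : X)) ∈ E} :=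
      (measure_preimage_vadd (μ := ρ) (-s) (Prod.swap ⁻¹' E)).symm
    have hg : Measurable fun y : Y =>
        fibreKernel ρ y {x : X | ((-s +ᵥ y : Y), (-s +ᵥ x : X)) ∈ E} :=
      Kernel.measurable_kernel_prodMk_left (κ := fibreKernel ρ) (measurable_swap hE')
    rw [Measure.map_apply measurable_swap hE, hinv, measure_eq_lintegral_fibreKernel h2 hE',
      Measure.compProd_apply hE]
    refine ((measurePreserving_vadd s ν).lintegral_comp hg).symm.trans ?_
    refine lintegral_congr fun y => ?_
    rw [hκy _ _ (measurable_prodMk_left hE)]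
    simp
  have huniq := eq_condKernel_of_measure_eq_compProd κ hdis
  rw [fst_map_swap_eq h2] at huniq
  filter_upwards [huniq] with y hy x
  have h3 : κ y {x} = fibreKernel ρ y {x} := by rw [hy]; rfl
  rw [← h3, hκy _ _ (measurableSet_singleton x)]
  congr 1
  ext z
  simp [neg_vadd_eq_iff]

end Atoms

/-! ### Joinings of a flow with the Ratner property -/

section Conclusion

variable {X Y : Type*} [MetricSpace X] [MeasurableSpace X] [BorelSpace X]
  [MeasurableSpace Y] [AddAction ℝ X] [AddAction ℝ Y]

/-- If nearby points of the fibres of `W` are in the same orbit and only countably many translations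
of the first coordinate relate generic points, then `W` has countably many generic points in each
fibre. -/
theorem countable_fibre_inter_flowGenericPoints [SecondCountableTopology X]
    [MeasurableSpace.CountablyGenerated Y] [MeasurableVAdd₂ ℝ X] {ρ : Measure (X × Y)}
    (hH : (translationGroup ρ : Set ℝ).Countable) {s δ : ℝ} (hδ : 0 < δ) {W : Set (X × Y)}
    (hW : ∀ x x' y, (x, y) ∈ W → (x', y) ∈ W → dist x x' < δ → x' ∈ AddAction.orbit ℝ x) (y : Y) :
    {x | (x, y) ∈ W ∧ (x, y) ∈ flowGenericPoints ρ s}.Countable := by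
  set S := {x | (x, y) ∈ W ∧ (x, y) ∈ flowGenericPoints ρ s} with hS
  rcases isEmpty_or_nonempty X with hX | hX
  · exact S.to_countable
  -- Points of `S` in one ball are less than `δ` apart, hence translates of one of them by elements
  -- of the countable translation group.
  have hcover : S ⊆ ⋃ n, S ∩ Metric.ball (TopologicalSpace.denseSeq X n) (δ / 2) := by
    intro x hx
    obtain ⟨n, hn⟩ := (TopologicalSpace.denseRange_denseSeq X).exists_dist_lt x (half_pos hδ)
    exact mem_iUnion.2 ⟨n, hx, hn⟩
  refine (countable_iUnion fun n => ?_).mono hcover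
  rcases (S ∩ Metric.ball (TopologicalSpace.denseSeq X n) (δ / 2)).eq_empty_or_nonempty
    with h | ⟨x, hx, hxn⟩
  · rw [h]
    exact countable_empty
  refine (hH.image fun t => t +ᵥ x).mono ?_
  rintro x' ⟨hx', hxn'⟩
  have hd : dist x x' < δ := by
    have := dist_triangle_right x x' (TopologicalSpace.denseSeq X n)
    rw [Metric.mem_ball] at hxn hxn'
    linarith
  obtain ⟨t, rfl⟩ := hW x x' y hx.1 hx'.1 hd
  exact ⟨t, mem_translationGroup_of_mem_flowGenericPoints hx.2 hx'.2, rfl⟩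

/-- Atomless fibre measures would not charge the countable set of generic points of `W` in each
fibre, and `W` would be null. -/
theorem not_ae_fibreMass_eq_zero [StandardBorelSpace X] [Nonempty X] [SecondCountableTopology X]
    [MeasurableSpace.CountablyGenerated Y] [MeasurableVAdd₂ ℝ X] {ν : Measure Y}
    {ρ : Measure (X × Y)} [IsProbabilityMeasure ρ] (h2 : ρ.map Prod.snd = ν)
    (hH : (translationGroup ρ : Set ℝ).Countable) {s : ℝ}
    (hs : Ergodic (fun w : X × Y => s +ᵥ w) ρ) {δ : ℝ} (hδ : 0 < δ) {W : Set (X × Y)}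
    (hWm : MeasurableSet W) (hW0 : ρ W ≠ 0)
    (hW : ∀ x x' y, (x, y) ∈ W → (x', y) ∈ W → dist x x' < δ → x' ∈ AddAction.orbit ℝ x) :
    ¬∀ᵐ w ∂ρ, fibreMass ρ w = 0 := by
  intro h0
  refine hW0 ?_
  rw [measure_eq_lintegral_fibreKernel h2 hWm, lintegral_eq_zero_of_ae_eq_zero]
  filter_upwards [ae_ae_fibreKernel h2 h0, ae_ae_fibreKernel h2 (ae_mem_flowGenericPoints hs)]
    with y hy hgen
  have hcount := countable_fibre_inter_flowGenericPoints hH hδ hW (s := s) y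
  have hnull : fibreKernel ρ y {x | ((x, y) ∈ W ∧ (x, y) ∈ flowGenericPoints ρ s) ∧
      fibreMass ρ (x, y) = 0} = 0 := by
    rw [← biUnion_of_singleton {x | ((x, y) ∈ W ∧ (x, y) ∈ flowGenericPoints ρ s) ∧
      fibreMass ρ (x, y) = 0}, measure_biUnion_null_iff (hcount.mono fun x hx => hx.1)]
    exact fun x hx => hx.2
  rw [Pi.zero_apply]
  refine measure_mono_null_ae ?_ hnull
  filter_upwards [hy, hgen] with x hx hxg hxW
  exact ⟨⟨hxW, hxg⟩, hx⟩

end Conclusion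

/-! ### The dichotomy for joinings -/

theorem mainTheorem3
    {X : Type*} [MetricSpace X] [SigmaCompactSpace X] [MeasurableSpace X] [BorelSpace X]
    (μ : Measure X) [IsProbabilityMeasure μ]
    [AddAction ℝ X] [MeasurableVAdd₂ ℝ X] (hS : ErgodicVAdd ℝ X μ)
    (P : Finset ℝ) (hPne : P.Nonempty) (hP0 : (0 : ℝ) ∉ P)
    (hSP : ∀ p ∈ P, Ergodic (fun x : X => p +ᵥ x) μ)
    (hR : RatnerProperty μ P)
    {Y : Type*} [MeasurableSpace Y] [StandardBorelSpace Y]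
    (ν : Measure Y) [IsProbabilityMeasure ν]
    [AddAction ℝ Y] [MeasurableVAdd₂ ℝ Y] (hT : ErgodicVAdd ℝ Y ν)
    (ρ : Measure (X × Y)) (hρ : IsJoining μ ν ρ) (hρe : ErgodicVAdd ℝ (X × Y) ρ) :
    ρ = μ.prod ν ∨ IsFiniteExtension (Prod.snd : X × Y → Y) ρ ν := by
  have hprob := hρ.isProbabilityMeasure
  have hinv := hρ.invariant
  have hXne : Nonempty X := nonempty_of_isProbabilityMeasure μ
  have hX : StandardBorelSpace X := standardBorelSpace_of_sigmaCompactSpace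
  have hXsc : SecondCountableTopology X := inferInstance
  have hmeas : MeasurableVAdd₂ ℝ (X × Y) :=
    ⟨(measurable_fst.vadd (measurable_fst.comp measurable_snd)).prodMk
      (measurable_fst.vadd (measurable_snd.comp measurable_snd))⟩
  refine or_iff_not_imp_left.2 fun hne => ?_
  obtain ⟨t₀, ht₀, herg⟩ : ∃ t₀, RatnerPropertyAt μ t₀ P ∧
      Ergodic (fun w : X × Y => t₀ +ᵥ w) ρ := by
    by_contra! hcon
    exact hR ((countable_setOf_not_ergodic (ρ := ρ)).mono hcon)
  obtain ⟨p, hp⟩ := hPne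
  have hH := countable_translationGroup hρ.map_fst hρ.map_snd (hSP p hp) hne
  obtain ⟨δ, hδ, W, hWm, hW0, hW⟩ := ht₀.exists_fibre_separated hρ.map_fst herg
    fun q hq h => hne (eq_prod_of_map_vadd_fst_eq hρ.map_fst hρ.map_snd (hSP q hq) h)
  have hmass := not_ae_fibreMass_eq_zero hρ.map_snd hH herg hδ hWm hW0 hW
  -- Equivariance of the fibre measures makes the mass invariant, hence constant by ergodicity of
  -- the time-`t₀` map; the constant is nonzero by `hmass`.
  have hmass_inv : fibreMass ρ ∘ (fun w : X × Y => t₀ +ᵥ w) =ᵐ[ρ] fibreMass ρ := by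
    have h1 : ∀ᵐ w ∂ρ, ∀ x, fibreKernel ρ (t₀ +ᵥ w.2) {t₀ +ᵥ x} = fibreKernel ρ w.2 {x} := by
      have h2 := fibreKernel_vadd_ae_eq hρ.map_snd t₀
      rw [← hρ.map_snd] at h2
      exact ae_of_ae_map measurable_snd.aemeasurable h2
    filter_upwards [h1] with w hw using hw w.1
  obtain ⟨c, hc⟩ := herg.ae_eq_const_of_ae_eq_comp₀
    measurable_fibreMass.nullMeasurable hmass_inv
  refine isFiniteExtension_of_fibreMass_ae_eq hρ.map_snd (c := c) ?_ hc
  rintro rfl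
  exact hmass hc
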